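/- For $f,g\in L^2(\mathbb{R}^d)$ let $V_gf(x,\xi)=\int_{\mathbb{R}^d} f(t)\overline{g(t-x)}e^{-2\pi i\xi\cdot t}\,dt$, $(x,\xi)\in\mathbb{R}^{2d}$, be the short-time Fourier transform. For a compact set $\Omega\subset\mathbb{R}^{2d}$ let $H_\Omega$ be the localization operator on $L^2(\mathbb{R}^d)$ given by $$H_\Omega f(t)=\int_{\Omega} V_gf(x,\xi)\,g(t-x)\,e^{2\pi i\xi\cdot t}\,dx\,d\xi ,$$ and let $|\partial\Omega|=\sup\{\int_{\Omega}\operatorname{div}\phi(z)\,dz:\ \phi\in C_c^1(\mathbb{R}^{2d},\mathbb{R}^{2d}),\ |\phi|_2\le 1\}$ be the perimeter of $\Omega$. A diagonalization of $H_\Omega$ consists of real numbers $\lambda_1\ge\lambda_2\ge\cdots$, all nonzero, and orthonormal functions $h_1,h_2,\dots$ in $L^2(\mathbb{R}^d)$, with $1\le k\le N$ for some $N\in\{0,1,2,\dots\}\cup\{\infty\}$ (indices $k<\infty$ if $N=\infty$), such that $H_\Omega f=\sum_{k}\lambda_k\langle f,h_k\rangle h_k$ in $L^2(\mathbb{R}^d)$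 for all $f\in L^2(\mathbb{R}^d)$. Thus the $\lambda_k$ are the nonzero eigenvalues of $H_\Omega$, counted with multiplicity and ordered non-increasingly, and the $h_k$ are corresponding orthonormal eigenfunctions. **Theorem.** Let $g\in L^2(\mathbb{R}^d)$ with $\|g\|_2=1$ and $\int_{\mathbb{R}^{2d}}|z|\,|V_gg(z)|^2\,dz<\infty$. Then there is a constant $C_g$, depending only on $g$, such that for every compact set $\Omega\subset\mathbb{R}^{2d}$ with finite perimeter and $|\partial\Omega|\ge 1$ the following holds. The operator $H_\Omega$ has a diagonalization, and for every diagonalization $(\lambda_k,h_k)_{1\le k\le N}$ of $H_\Omega$ one has $N\ge A_\Omega:=\lceil|\Omega|\rceil$, and the accumulated spectrogram $$\rho_{g,\Omega}(z)=\sum_{k=1}^{A_\Omega}|V_gh_k(z)|^2,\qquad z\in\mathbb{R}^{2d},$$ satisfies $$\|\rho_{g,\Omega}-1_\Omega\|_{L^1(\mathbb{R}^{2d})}\le C_g\,|\partial\Omega| .$$ -/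

import Mathlib

open MeasureTheory
open scoped ENNReal NNReal

noncomputable section

namespace AccSpec

/-- `ℝ^d` with the Euclidean norm and Lebesgue measure. -/
abbrev Rd (d : ℕ) : Type := EuclideanSpace ℝ (Fin d)

/-- The time-frequency plane `ℝ^{2d}`, with points `z = (x, ξ)`, the Euclidean norm and
Lebesgue measure. -/
abbrev Phase (d : ℕ) : Type := EuclideanSpace ℝ (Fin d ⊕ Fin d)

/-- The Hilbert space `L²(ℝ^d)` of complex-valued functions. -/
abbrev L2 (d : ℕ) : Type := Lp ℂ 2 (volume : Measure (Rd d))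

/-- The time component `x` of `z = (x, ξ)`. -/
def timePart {d : ℕ} (z : Phase d) : Rd d := WithLp.toLp 2 (fun i => z (Sum.inl i))

/-- The frequency component `ξ` of `z = (x, ξ)`. -/
def freqPart {d : ℕ} (z : Phase d) : Rd d := WithLp.toLp 2 (fun i => z (Sum.inr i))

/-- The short-time Fourier transform
`V_g f (x, ξ) = ∫ f(t) conj(g(t - x)) exp(-2πi ξ·t) dt`. -/
def stft {d : ℕ} (g f : Rd d → ℂ) (z : Phase d) : ℂ :=
  ∫ t : Rd d, f t * (starRingEnd ℂ) (g (t - timePart z)) *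
    Complex.exp (-(2 * Real.pi * Complex.I * ((inner ℝ (freqPart z) t : ℝ) : ℂ)))

/-- The spectrogram `Spec_g f = |V_g f|²`. -/
def spectrogram {d : ℕ} (g f : Rd d → ℂ) (z : Phase d) : ℝ := ‖stft g f z‖ ^ 2

/-- `‖g‖²_{M*} = ∫ |z| |V_g g(z)|² dz`, as an extended nonnegative number. -/
def mStarNormSq {d : ℕ} (g : Rd d → ℂ) : ℝ≥0∞ :=
  ∫⁻ z : Phase d, ENNReal.ofReal (‖z‖ * ‖stft g g z‖ ^ 2)

/-- The localization operator with window `g` and domain `Ω`: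
`H_Ω f (t) = ∫_Ω V_g f(x, ξ) g(t - x) exp(2πi ξ·t) dx dξ`. -/
def locOp {d : ℕ} (g : Rd d → ℂ) (Ω : Set (Phase d)) (f : Rd d → ℂ) (t : Rd d) : ℂ :=
  ∫ z in Ω, stft g f z * g (t - timePart z) *
    Complex.exp (2 * Real.pi * Complex.I * ((inner ℝ (freqPart z) t : ℝ) : ℂ))

/-- `(lam k, h k)`, for `k < N` (`N` possibly infinite), is a diagonalization of `H_Ω` on
`L²(ℝ^d)`: the `lam k` are nonzero and ordered non-increasingly, the `h k` are orthonormal, and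
`H_Ω f = ∑_{k < N} lam k ⟨f, h k⟩ h k` for all `f ∈ L²(ℝ^d)`. Indices start at `0`, and the
values of `lam` and `h` at indices `k ≥ N` carry no meaning. -/
structure IsDiagonalization {d : ℕ} (g : L2 d) (Ω : Set (Phase d))
    (N : ℕ∞) (lam : ℕ → ℝ) (h : ℕ → L2 d) : Prop where
  ne_zero : ∀ k : ℕ, (k : ℕ∞) < N → lam k ≠ 0
  antitone : ∀ j k : ℕ, j ≤ k → (k : ℕ∞) < N → lam k ≤ lam j
  orthonormal : Orthonormal ℂ (fun k : {k : ℕ // (k : ℕ∞) < N} => h k)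
  expansion : ∀ f : L2 d, ∃ F : L2 d,
    (F : Rd d → ℂ) =ᵐ[volume] locOp g Ω f ∧
    HasSum (fun k : {k : ℕ // (k : ℕ∞) < N} => ((lam k : ℂ) * inner ℂ (h k) f) • h k) F

/-- `A_Ω`, the smallest integer greater than or equal to `|Ω|` (for `Ω` of finite measure). -/
def numEig {d : ℕ} (Ω : Set (Phase d)) : ℕ := ⌈(volume Ω).toReal⌉₊

/-- The accumulated spectrogram: the sum of the spectrograms of the first `A_Ω` functions of the
sequence `h`. -/
def accSpectrogram {d : ℕ} (g : L2 d) (Ω : Set (Phase d)) (h : ℕ → L2 d) (z : Phase d) : ℝ :=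
  ∑ k ∈ Finset.range (numEig Ω), spectrogram g (h k) z

/-- The divergence of a vector field on Euclidean space. -/
def divergence {ι : Type} [Fintype ι] [DecidableEq ι]
    (φ : EuclideanSpace ℝ ι → EuclideanSpace ℝ ι) (x : EuclideanSpace ℝ ι) : ℝ :=
  ∑ i, (fderiv ℝ φ x (EuclideanSpace.single i 1)) i

/-- The variation `Var f = sup {∫ f div φ : φ ∈ C_c^1, |φ|₂ ≤ 1}` of an integrable function, as
an extended nonnegative number (the field `φ = 0` contributes `0` to the supremum). -/
def variation {ι : Type} [Fintype ι] [DecidableEq ι] (f : EuclideanSpace ℝ ι → ℝ) : ℝ≥0∞ :=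
  ⨆ (φ : EuclideanSpace ℝ ι → EuclideanSpace ℝ ι) (_ : ContDiff ℝ 1 φ)
    (_ : HasCompactSupport φ) (_ : ∀ x, ‖φ x‖ ≤ 1),
    ENNReal.ofReal (∫ x, f x * divergence φ x)

/-- The perimeter `|∂Ω| = Var 1_Ω`. -/
def perimeter {ι : Type} [Fintype ι] [DecidableEq ι] (Ω : Set (EuclideanSpace ℝ ι)) : ℝ≥0∞ :=
  variation (Ω.indicator (fun _ => (1 : ℝ)))

end AccSpec

end

/-! Write `B` for the map `f ↦ V_g f` restricted to `Ω`, so that `H_Ω = B†B` (`locL2_ae_eq`).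
Bessel's inequality for the time-frequency shifts `π(z)g` makes `B` Hilbert–Schmidt, and the
spectral theorem then gives a diagonalization.

For an arbitrary diagonalization, everything is read off the quadratic form `⟨H_Ω f, f⟩ = ∑ λ_k |⟨f,
h_k⟩|² = ∫_Ω |V_g f|²` (`hasSum_norm_inner_sq`). Taking `f = h_k` gives `λ_k = ∫_Ω |V_g h_k|²`,
which lies in `[0, 1]` by Plancherel. Taking `f = π(z)g` gives `∑ λ_k |V_g h_k(z)|² = S(z)`, where
`S = smoothInd g Ω` is `1_Ω` averaged against the probability density `|V_g g|²`.

Let `D = ‖S - 1_Ω‖₁`. The translation estimate for sets of finite perimeter gives `D ≤ ‖g‖²_{M*}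
|∂Ω|`. Integrating the series for `S` over the plane gives `∑ λ_k = |Ω|`, and over `Ω` gives `∑
λ_k²`; hence `∑ λ_k (1 - λ_k) ≤ D`, so few eigenvalues are far from both `0` and `1`. By
monotonicity the sequence `λ` is within `4D + 1` in `ℓ¹` of the indicator of its first `⌈|Ω|⌉`
indices (`tsum_abs_indicator_sub_le`). Since each `|V_g h_k|²` has integral one, this also bounds
`‖ρ - S‖₁`. The triangle inequality then gives `5D + 1`, and the `1` is absorbed by `|∂Ω| ≥ 1`. -/

noncomputable section

namespace AccSpec

/-! ### Plancherel for the Fourier integral on `L¹ ∩ L²`. -/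

section Plancherel

open scoped FourierTransform SchwartzMap ContDiff

variable {E : Type*} [NormedAddCommGroup E] [InnerProductSpace ℝ E] [FiniteDimensional ℝ E]
  [MeasurableSpace E] [BorelSpace E]

/-- On `L¹ ∩ L²` the Fourier integral agrees with the `L²` Fourier transform. -/
theorem fourier_toLp_ae_eq {f : E → ℂ} (h1 : Integrable f) (h2 : MemLp f 2) :
    𝓕 f =ᵐ[volume] (𝓕 (h2.toLp f) : Lp ℂ 2 (volume : Measure E)) := by
  have hcont : Continuous (𝓕 f) :=
    VectorFourier.fourierIntegral_continuous Real.continuous_fourierChar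
      continuous_inner h1
  refine ae_eq_of_integral_contDiff_smul_eq hcont.locallyIntegrable
    ((Lp.memLp _).locallyIntegrable (by norm_num)) fun φ hφ hs => ?_
  have hs' : HasCompactSupport (fun x => (φ x : ℂ)) :=
    hs.comp_left (g := fun r : ℝ => (r : ℂ)) Complex.ofReal_zero
  have hφ' : ContDiff ℝ ∞ (fun x => (φ x : ℂ)) := Complex.ofRealCLM.contDiff.comp hφ
  set ψ : 𝓢(E, ℂ) := hs'.toSchwartzMap hφ' with hψ
  have hψx : ∀ x, ψ x = (φ x : ℂ) := fun x => rfl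
  -- Both transforms are tested against `φ` and moved onto it: the `L²` one through tempered
  -- distributions, the integral one (`e2`) through Fubini.
  have e1 : ∫ x, φ x • (𝓕 (h2.toLp f) : Lp ℂ 2 (volume : Measure E)) x
      = ∫ x, (𝓕 ψ : 𝓢(E, ℂ)) x • f x := by
    have := congrArg (fun T => T ψ) (Lp.fourier_toTemperedDistribution_eq (h2.toLp f))
    simp only [TemperedDistribution.fourier_apply, Lp.toTemperedDistribution_apply] at this
    calc _ = ∫ x, ψ x • (𝓕 (h2.toLp f) : Lp ℂ 2 (volume : Measure E)) x := by
          simp [hψx]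
      _ = _ := this.symm
      _ = _ := integral_congr_ae (h2.coeFn_toLp.mono fun x hx => by simp only [hx])
  have e2 : ∫ x, 𝓕 f x • ψ x = ∫ x, f x • 𝓕 (ψ : E → ℂ) x := by
    simpa using! (VectorFourier.integral_fourierIntegral_smul_eq_flip (L := innerₗ E)
      Real.continuous_fourierChar continuous_inner h1 ψ.integrable)
  rw [e1]
  calc _ = ∫ x, 𝓕 f x • ψ x := by simp [hψx, mul_comm]
    _ = _ := e2
    _ = _ := by simp [SchwartzMap.fourier_coe, mul_comm]

theorem lintegral_enorm_fourier_sq {f : E → ℂ} (h1 : Integrable f) (h2 : MemLp f 2) :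
    ∫⁻ ξ, ‖𝓕 f ξ‖ₑ ^ 2 = ∫⁻ t, ‖f t‖ₑ ^ 2 := by
  have key : ∀ F : E → ℂ, ∫⁻ t, ‖F t‖ₑ ^ 2 = eLpNorm F 2 volume ^ 2 := fun F => by
    rw [eLpNorm_eq_lintegral_rpow_enorm_toReal (by norm_num) (by norm_num),
      ← ENNReal.rpow_natCast, ← ENNReal.rpow_mul]
    simp
  rw [key, key, eLpNorm_congr_ae (fourier_toLp_ae_eq h1 h2), ← Lp.enorm_def,
    ← eLpNorm_congr_ae h2.coeFn_toLp, ← Lp.enorm_def]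
  congr 1
  rw [← ofReal_norm, ← ofReal_norm, Lp.norm_fourier_eq]

end Plancherel

/-! ### Time-frequency shifts and the short-time Fourier transform. -/

variable {d : ℕ}

theorem continuous_timePart : Continuous (timePart : Phase d → Rd d) := by
  unfold timePart; fun_prop

theorem continuous_freqPart : Continuous (freqPart : Phase d → Rd d) := by
  unfold freqPart; fun_prop

theorem measurePreserving_timePart_freqPart :
    MeasurePreserving (fun z : Phase d => (timePart z, freqPart z)) volume volume := by
  have h1 := PiLp.volume_preserving_ofLp (Fin d ⊕ Fin d)
  have h2 := volume_measurePreserving_sumPiEquivProdPi (fun _ : Fin d ⊕ Fin d => ℝ)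
  have h3 := (PiLp.volume_preserving_toLp (Fin d)).prod (PiLp.volume_preserving_toLp (Fin d))
  exact (h3.comp h2).comp h1

theorem lintegral_phase {F : Rd d × Rd d → ℝ≥0∞} (hF : Measurable F) :
    ∫⁻ z : Phase d, F (timePart z, freqPart z) = ∫⁻ x, ∫⁻ ξ, F (x, ξ) := by
  rw [measurePreserving_timePart_freqPart.lintegral_comp hF, Measure.volume_eq_prod,
    lintegral_prod _ hF.aemeasurable]

/-- The time-frequency shift `π(z)g(t) = exp(2πi ξ·t) g(t - x)` for `z = (x, ξ)`. -/
def tfShift (g : Rd d → ℂ) (z : Phase d) (t : Rd d) : ℂ :=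
  Complex.exp (2 * Real.pi * Complex.I * ((inner ℝ (freqPart z) t : ℝ) : ℂ)) * g (t - timePart z)

theorem norm_exp_two_pi_I (r : ℝ) : ‖Complex.exp (2 * Real.pi * Complex.I * (r : ℂ))‖ = 1 := by
  have : (2 * Real.pi * Complex.I * (r : ℂ)) = ((2 * Real.pi * r : ℝ) : ℂ) * Complex.I := by
    push_cast; ring
  rw [this, Complex.norm_exp_ofReal_mul_I]

theorem conj_exp_two_pi_I (r : ℝ) :
    (starRingEnd ℂ) (Complex.exp (2 * Real.pi * Complex.I * (r : ℂ)))
      = Complex.exp (-(2 * Real.pi * Complex.I * (r : ℂ))) := by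
  rw [← Complex.exp_conj]; simp [map_ofNat]

theorem norm_tfShift (g : Rd d → ℂ) (z : Phase d) (t : Rd d) :
    ‖tfShift g z t‖ = ‖g (t - timePart z)‖ := by
  rw [tfShift, norm_mul, norm_exp_two_pi_I, one_mul]

theorem conj_tfShift (g : Rd d → ℂ) (z : Phase d) (t : Rd d) :
    (starRingEnd ℂ) (tfShift g z t) = (starRingEnd ℂ) (g (t - timePart z)) *
      Complex.exp (-(2 * Real.pi * Complex.I * ((inner ℝ (freqPart z) t : ℝ) : ℂ))) := by
  rw [tfShift, map_mul, conj_exp_two_pi_I, mul_comm]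

theorem stft_eq_integral_tfShift (g f : Rd d → ℂ) (z : Phase d) :
    stft g f z = ∫ t, f t * (starRingEnd ℂ) (tfShift g z t) := by
  simp only [stft, conj_tfShift, mul_assoc]

theorem locOp_eq_integral_tfShift (g f : Rd d → ℂ) (Ω : Set (Phase d)) (t : Rd d) :
    locOp g Ω f t = ∫ z in Ω, stft g f z * tfShift g z t := by
  simp only [locOp, tfShift, mul_assoc, mul_comm]

theorem stronglyMeasurable_tfShift {g : Rd d → ℂ} (hg : StronglyMeasurable g) :
    StronglyMeasurable (fun p : Phase d × Rd d => tfShift g p.1 p.2) := by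
  refine StronglyMeasurable.mul (Continuous.stronglyMeasurable ?_)
    (hg.comp_measurable (Continuous.measurable ?_))
  · have := continuous_freqPart (d := d)
    fun_prop
  · have := continuous_timePart (d := d)
    fun_prop

theorem memLp_tfShift (g : L2 d) (z : Phase d) : MemLp (tfShift g z) 2 := by
  have h := (Lp.memLp g).comp_measurePreserving
    (measurePreserving_sub_right (volume : Measure (Rd d)) (timePart z))
  refine h.congr_norm
    ((stronglyMeasurable_tfShift (Lp.stronglyMeasurable g)).comp_measurable
      measurable_prodMk_left).aestronglyMeasurable (.of_forall fun t => ?_)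
  rw [norm_tfShift]; rfl

/-- The time-frequency shift of `g` as an element of `L²`. -/
def tfL2 (g : L2 d) (z : Phase d) : L2 d := (memLp_tfShift g z).toLp _

theorem norm_tfL2 (g : L2 d) (z : Phase d) : ‖tfL2 g z‖ = ‖g‖ := by
  rw [tfL2, Lp.norm_toLp, Lp.norm_def]
  congr 1
  rw [← eLpNorm_comp_measurePreserving (Lp.aestronglyMeasurable g)
    (measurePreserving_sub_right (volume : Measure (Rd d)) (timePart z))]
  exact eLpNorm_congr_norm_ae (.of_forall fun t => norm_tfShift _ _ _)

/-- This form gives linearity in `f`, the uniform bound by Cauchy–Schwarz, and access to Bessel's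
inequality. -/
theorem stft_eq_inner (g f : L2 d) (z : Phase d) : stft g f z = inner ℂ (tfL2 g z) f := by
  rw [L2.inner_def, stft_eq_integral_tfShift]
  refine integral_congr_ae ((memLp_tfShift g z).coeFn_toLp.mono fun t ht => ?_)
  simp only [RCLike.inner_apply]
  rw [tfL2, ht]

theorem norm_stft_le (g f : L2 d) (z : Phase d) : ‖stft g f z‖ ≤ ‖g‖ * ‖f‖ := by
  rw [stft_eq_inner, ← norm_tfL2 g z]
  exact norm_inner_le_norm _ _

theorem stronglyMeasurable_stft (g f : L2 d) : StronglyMeasurable (stft g f) := by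
  have h : StronglyMeasurable (fun p : Phase d × Rd d =>
      f p.2 * (starRingEnd ℂ) (tfShift g p.1 p.2)) :=
    ((Lp.stronglyMeasurable f).comp_measurable measurable_snd).mul
      (RCLike.continuous_conj.comp_stronglyMeasurable
        (stronglyMeasurable_tfShift (Lp.stronglyMeasurable g)))
  have h' := h.integral_prod_right' (ν := (volume : Measure (Rd d)))
  exact (funext (stft_eq_integral_tfShift (⇑g) (⇑f)) : stft g f = _) ▸ h'

theorem measurable_stft (g f : L2 d) : Measurable (stft g f) := (stronglyMeasurable_stft g f).measurable

/-- The spectrogram of a time-frequency shift of the window is a translate. -/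
theorem norm_stft_tfL2 (g : L2 d) (z w : Phase d) :
    ‖stft g (tfL2 g z) w‖ = ‖stft g g (w - z)‖ := by
  have h1 : stft g (tfL2 g z) w = ∫ t, tfShift g z t * (starRingEnd ℂ) (tfShift g w t) := by
    rw [stft_eq_integral_tfShift]
    refine integral_congr_ae ((memLp_tfShift g z).coeFn_toLp.mono fun t ht => ?_)
    simp only
    rw [tfL2, ht]
  rw [h1, ← integral_add_right_eq_self _ (timePart z), stft_eq_integral_tfShift]
  -- Covariance: after the substitution `t ↦ t + x`, composing the two shifts leaves a single shift
  -- by `w - z` and a phase independent of `t`, which the norm discards.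
  have h2 : ∀ t, tfShift g z (t + timePart z) * (starRingEnd ℂ) (tfShift g w (t + timePart z)) =
      Complex.exp (2 * Real.pi * Complex.I *
        ((inner ℝ (freqPart z - freqPart w) (timePart z) : ℝ) : ℂ)) *
      (g t * (starRingEnd ℂ) (tfShift g (w - z) t)) := by
    intro t
    have e1 : freqPart (w - z) = freqPart w - freqPart z := rfl
    have e2 : timePart (w - z) = timePart w - timePart z := rfl
    rw [conj_tfShift, conj_tfShift, tfShift, e1, e2, add_sub_cancel_right,
      show t + timePart z - timePart w = t - (timePart w - timePart z) by abel]
    have : Complex.exp (2 * Real.pi * Complex.I * ((inner ℝ (freqPart z) (t + timePart z) : ℝ) : ℂ)) *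
        Complex.exp (-(2 * Real.pi * Complex.I * ((inner ℝ (freqPart w) (t + timePart z) : ℝ) : ℂ)))
        = Complex.exp (2 * Real.pi * Complex.I *
          ((inner ℝ (freqPart z - freqPart w) (timePart z) : ℝ) : ℂ)) *
          Complex.exp (-(2 * Real.pi * Complex.I *
            ((inner ℝ (freqPart w - freqPart z) t : ℝ) : ℂ))) := by
      rw [← Complex.exp_add, ← Complex.exp_add]
      congr 1
      simp only [inner_add_right, inner_sub_left]
      push_cast
      ring
    linear_combination (g t * (starRingEnd ℂ) (g (t - (timePart w - timePart z)))) * this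
  simp_rw [h2]
  rw [integral_const_mul, norm_mul, norm_exp_two_pi_I, one_mul]

theorem lintegral_enorm_sq_L2 (f : L2 d) : ∫⁻ t, ‖f t‖ₑ ^ 2 = ‖f‖ₑ ^ 2 := by
  rw [Lp.enorm_def, eLpNorm_eq_lintegral_rpow_enorm_toReal (by norm_num) (by norm_num),
    ← ENNReal.rpow_natCast, ← ENNReal.rpow_mul]
  simp

theorem measurable_fourier_prodMk {P : Rd d → Rd d → ℂ}
    (hP : Measurable (fun p : Rd d × Rd d => P p.1 p.2)) :
    Measurable (fun p : Rd d × Rd d => FourierTransform.fourier (P p.1) p.2) := by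
  have hc : Continuous (fun q : (Rd d × Rd d) × Rd d =>
      Complex.exp (((-2 * Real.pi * inner ℝ q.2 q.1.2 : ℝ) : ℂ) * Complex.I)) := by
    fun_prop
  have h : StronglyMeasurable (fun q : (Rd d × Rd d) × Rd d =>
      Complex.exp (((-2 * Real.pi * inner ℝ q.2 q.1.2 : ℝ) : ℂ) * Complex.I) • P q.1.1 q.2) :=
    (hc.measurable.smul
      (hP.comp ((measurable_fst.comp measurable_fst).prodMk measurable_snd))).stronglyMeasurable
  have h' := (h.integral_prod_right' (ν := (volume : Measure (Rd d)))).measurable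
  simpa only [Real.fourier_eq'] using h'

/-- The product `f · conj g(· - x)` whose Fourier transform is the slice of the short-time Fourier
transform at time `x`. -/
def windowed (g f : Rd d → ℂ) (x t : Rd d) : ℂ := f t * (starRingEnd ℂ) (g (t - x))

theorem stft_eq_fourier (g f : Rd d → ℂ) (z : Phase d) :
    stft g f z = FourierTransform.fourier (windowed g f (timePart z)) (freqPart z) := by
  rw [Real.fourier_eq', stft]
  refine integral_congr_ae (.of_forall fun t => ?_)
  simp only [smul_eq_mul, windowed]
  rw [mul_comm]
  congr 2
  rw [real_inner_comm]
  push_cast; ring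

theorem measurable_windowed (g f : L2 d) :
    Measurable (fun p : Rd d × Rd d => windowed g f p.1 p.2) :=
  ((Lp.stronglyMeasurable f).measurable.comp measurable_snd).mul
    (RCLike.continuous_conj.measurable.comp
      ((Lp.stronglyMeasurable g).measurable.comp (measurable_snd.sub measurable_fst)))

theorem integrable_windowed (g f : L2 d) (x : Rd d) : Integrable (windowed g f x) :=
  (Lp.memLp f).integrable_mul (q := 2) ((Lp.memLp g).comp_measurePreserving
    (measurePreserving_sub_right (volume : Measure (Rd d)) x)).star

theorem lintegral_lintegral_windowed (g f : L2 d) :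
    ∫⁻ x, ∫⁻ t, ‖windowed g f x t‖ₑ ^ 2 = ‖g‖ₑ ^ 2 * ‖f‖ₑ ^ 2 := by
  have hgm := (Lp.stronglyMeasurable g).measurable
  have hfm := (Lp.stronglyMeasurable f).measurable
  rw [lintegral_lintegral_swap ((measurable_windowed g f).enorm.pow_const 2).aemeasurable]
  have : ∀ t, ∫⁻ x, ‖windowed g f x t‖ₑ ^ 2 = ‖f t‖ₑ ^ 2 * ‖g‖ₑ ^ 2 := fun t => by
    simp only [windowed, enorm_mul, mul_pow, RCLike.enorm_conj]
    have hm : Measurable (fun x => ‖g (t - x)‖ₑ ^ 2) :=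
      (hgm.comp (measurable_const.sub measurable_id)).enorm.pow_const 2
    rw [lintegral_const_mul _ hm, lintegral_sub_left_eq_self (fun x => ‖g x‖ₑ ^ 2) t,
      lintegral_enorm_sq_L2]
  simp_rw [this]
  rw [lintegral_mul_const _ (hfm.enorm.pow_const 2), lintegral_enorm_sq_L2, mul_comm]

/-- The short-time Fourier transform preserves `L²` norms up to the norm of the window. -/
theorem lintegral_enorm_stft_sq (g f : L2 d) :
    ∫⁻ z, ‖stft g f z‖ₑ ^ 2 = ‖g‖ₑ ^ 2 * ‖f‖ₑ ^ 2 := by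
  have hP := measurable_windowed g f
  have hFm := measurable_fourier_prodMk hP
  have htot := lintegral_lintegral_windowed g f
  have hne : ‖g‖ₑ ^ 2 * ‖f‖ₑ ^ 2 ≠ ∞ :=
    ENNReal.mul_ne_top (ENNReal.pow_ne_top enorm_ne_top) (ENNReal.pow_ne_top enorm_ne_top)
  have hm : Measurable fun x => ∫⁻ t, ‖windowed g f x t‖ₑ ^ 2 :=
    Measurable.lintegral_prod_right' (f := fun p : Rd d × Rd d => ‖windowed g f p.1 p.2‖ₑ ^ 2)
      (hP.enorm.pow_const 2)
  have hae : ∀ᵐ x, ∫⁻ t, ‖windowed g f x t‖ₑ ^ 2 < ∞ := ae_lt_top hm (htot ▸ hne)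
  have h1 := lintegral_phase
    (F := fun p => ‖FourierTransform.fourier (windowed g f p.1) p.2‖ₑ ^ 2) (hFm.enorm.pow_const 2)
  have h2 : ∫⁻ z, ‖stft g f z‖ₑ ^ 2 =
      ∫⁻ x, ∫⁻ ξ, ‖FourierTransform.fourier (windowed g f x) ξ‖ₑ ^ 2 := by
    rw [← h1]
    exact lintegral_congr fun z => by rw [stft_eq_fourier]
  rw [← htot, h2]
  -- Every slice is integrable, but Tonelli yields square integrability only for almost every `x`;
  -- Plancherel in `ξ` is applied on those slices.
  refine lintegral_congr_ae (hae.mono fun x hx => ?_)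
  refine lintegral_enorm_fourier_sq (integrable_windowed g f x)
    ⟨(integrable_windowed g f x).aestronglyMeasurable, ?_⟩
  rw [eLpNorm_lt_top_iff_lintegral_rpow_enorm_lt_top (by norm_num) (by norm_num)]
  simpa using hx

/-! ### Hilbert–Schmidt operators are compact. -/

section HilbertSchmidt

variable {H K ι : Type*} [NormedAddCommGroup H] [InnerProductSpace ℂ H]
  [NormedAddCommGroup K] [InnerProductSpace ℂ K] [CompleteSpace K]

/-- A Hilbert–Schmidt operator is compact. -/
theorem isCompactOperator_of_summable_norm_sq (B : H →L[ℂ] K) (b : HilbertBasis ι ℂ H)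
    (hs : Summable fun i => ‖B (b i)‖ ^ 2) : IsCompactOperator B := by
  classical
  let F : Finset ι → H →L[ℂ] K := fun s =>
    ∑ i ∈ s, (ContinuousLinearMap.toSpanSingleton ℂ (B (b i))).comp (innerSL ℂ (b i))
  have hF : ∀ s x, F s x = ∑ i ∈ s, inner ℂ (b i) x • B (b i) := fun s x => by
    simp [F]
  have hFc : ∀ s, IsCompactOperator (F s) := fun s => by
    have : F s ∈ compactOperator (RingHom.id ℂ) H K := by
      refine Submodule.sum_mem _ fun i _ => ?_
      exact (isCompactOperator_of_locallyCompactSpace_rng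
        (ContinuousLinearMap.toSpanSingleton ℂ (B (b i)))).comp_clm (innerSL ℂ (b i))
    exact this
  refine isCompactOperator_of_tendsto (l := Filter.atTop) (F := F) ?_ (.of_forall hFc)
  rw [Metric.tendsto_atTop]
  intro ε hε
  have hcau := (summable_iff_vanishing_norm.1 hs) ((ε / 2) ^ 2) (by positivity)
  obtain ⟨s, hs'⟩ := hcau
  refine ⟨s, fun t hst => ?_⟩
  rw [dist_comm, dist_eq_norm]
  refine lt_of_le_of_lt (ContinuousLinearMap.opNorm_le_bound _ (by positivity : 0 ≤ ε / 2)
    fun x => ?_) (by linarith)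
  have hsum : HasSum (fun i => inner ℂ (b i) x • B (b i)) (B x) := by
    have := B.hasSum (b.hasSum_repr x)
    simpa [b.repr_apply_apply] using this
  have hlim : Filter.Tendsto (fun t' => ‖(∑ i ∈ t', inner ℂ (b i) x • B (b i)) - F t x‖)
      Filter.atTop (nhds ‖B x - F t x‖) := (Filter.Tendsto.sub_const hsum _).norm
  refine le_of_tendsto hlim (Filter.eventually_atTop.2 ⟨t, fun t' htt' => ?_⟩)
  -- Cauchy–Schwarz splits the tail: Bessel controls the coefficients of `x`, and the choice of `s`
  -- makes the remaining factor at most `ε / 2`.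
  rw [hF, ← Finset.sum_sdiff htt', add_sub_cancel_right]
  calc _ ≤ ∑ i ∈ t' \ t, ‖inner ℂ (b i) x‖ * ‖B (b i)‖ :=
        (norm_sum_le _ _).trans_eq (by simp [norm_smul])
    _ ≤ √(∑ i ∈ t' \ t, ‖inner ℂ (b i) x‖ ^ 2) * √(∑ i ∈ t' \ t, ‖B (b i)‖ ^ 2) :=
        Real.sum_mul_le_sqrt_mul_sqrt _ _ _
    _ ≤ ‖x‖ * (ε / 2) := by
        gcongr
        · exact Real.sqrt_le_iff.2 ⟨norm_nonneg _, b.orthonormal.sum_inner_products_le x⟩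
        · refine Real.sqrt_le_iff.2 ⟨by positivity, ?_⟩
          have := hs' (t' \ t) (Finset.disjoint_left.2 fun i hi his =>
            (Finset.mem_sdiff.1 hi).2 (hst his))
          exact (le_abs_self _).trans this.le
    _ = _ := mul_comm _ _

end HilbertSchmidt

/-! ### The localization operator as `B†B`. -/

section Operator

variable (g : L2 d) (Ω : Set (Phase d)) [IsFiniteMeasure ((volume : Measure (Phase d)).restrict Ω)]

/-- On a set of finite measure the uniform bound on `V_g f` is enough; Plancherel is not needed. -/
theorem memLp_stft_restrict (f : L2 d) :
    MemLp (stft g f) 2 ((volume : Measure (Phase d)).restrict Ω) :=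
  MemLp.of_bound (stronglyMeasurable_stft g f).aestronglyMeasurable (‖g‖ * ‖f‖)
    (.of_forall fun z => norm_stft_le g f z)

theorem stft_add (f₁ f₂ : L2 d) (z : Phase d) :
    stft g (f₁ + f₂ : L2 d) z = stft g f₁ z + stft g f₂ z := by
  simp only [stft_eq_inner, inner_add_right]

theorem stft_smul (c : ℂ) (f : L2 d) (z : Phase d) :
    stft g (c • f : L2 d) z = c * stft g f z := by
  simp only [stft_eq_inner, inner_smul_right]

/-- The short-time Fourier transform restricted to `Ω`, as a bounded operator. -/
def stftRestrict : L2 d →L[ℂ] Lp ℂ 2 ((volume : Measure (Phase d)).restrict Ω) :=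
  LinearMap.mkContinuous
    { toFun := fun f => (memLp_stft_restrict g Ω f).toLp _
      map_add' := fun f₁ f₂ => by
        rw [← MemLp.toLp_add]
        exact MemLp.toLp_congr _ _ (.of_forall fun z => stft_add g f₁ f₂ z)
      map_smul' := fun c f => by
        rw [RingHom.id_apply, ← MemLp.toLp_const_smul]
        exact MemLp.toLp_congr _ _ (.of_forall fun z => stft_smul g c f z) }
    (measureUnivNNReal ((volume : Measure (Phase d)).restrict Ω) ^ ((2 : ℝ≥0∞).toReal⁻¹) * ‖g‖)
    fun f => by
      rw [mul_assoc]
      refine Lp.norm_le_of_ae_bound (by positivity) ?_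
      filter_upwards [(memLp_stft_restrict g Ω f).coeFn_toLp] with z hz
      rw [LinearMap.coe_mk, AddHom.coe_mk, hz]
      exact norm_stft_le g f z

theorem stftRestrict_ae_eq (f : L2 d) :
    stftRestrict g Ω f =ᵐ[(volume : Measure (Phase d)).restrict Ω] stft g f :=
  (memLp_stft_restrict g Ω f).coeFn_toLp

theorem inner_stftRestrict (u f : L2 d) :
    inner ℂ (stftRestrict g Ω u) (stftRestrict g Ω f) =
      ∫ z in Ω, stft g f z * (starRingEnd ℂ) (stft g u z) := by
  rw [L2.inner_def]
  refine integral_congr_ae ?_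
  filter_upwards [stftRestrict_ae_eq g Ω u, stftRestrict_ae_eq g Ω f] with z h1 h2
  rw [h1, h2, RCLike.inner_apply]

theorem norm_stftRestrict_sq (f : L2 d) :
    ‖stftRestrict g Ω f‖ ^ 2 = ∫ z in Ω, ‖stft g f z‖ ^ 2 := by
  have h := inner_stftRestrict g Ω f f
  rw [inner_self_eq_norm_sq_to_K] at h
  simp only [RCLike.mul_conj] at h
  have h' : ∫ z in Ω, ((‖stft g f z‖ : ℂ)) ^ 2 = ((∫ z in Ω, ‖stft g f z‖ ^ 2 : ℝ) : ℂ) := by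
    rw [← integral_complex_ofReal]; simp
  exact Complex.ofReal_injective ((Complex.ofReal_pow _ _).trans (h.trans h'))

/-- The localization operator as a bounded operator on `L²`. -/
def locL2 : L2 d →L[ℂ] L2 d := (stftRestrict g Ω).adjoint ∘L stftRestrict g Ω

theorem inner_locL2 (u f : L2 d) :
    inner ℂ u (locL2 g Ω f) = ∫ z in Ω, stft g f z * (starRingEnd ℂ) (stft g u z) := by
  rw [locL2, ContinuousLinearMap.comp_apply, ContinuousLinearMap.adjoint_inner_right,
    inner_stftRestrict]

theorem integral_tfShift_mul_conj (u : L2 d) (z : Phase d) :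
    ∫ t, tfShift g z t * (starRingEnd ℂ) (u t) = (starRingEnd ℂ) (stft g u z) := by
  rw [stft_eq_integral_tfShift, ← integral_conj]
  simp only [map_mul, Complex.conj_conj, mul_comm]

theorem integrable_tfShift_mul_conj (u : L2 d) (z : Phase d) :
    Integrable fun t => tfShift g z t * (starRingEnd ℂ) (u t) :=
  (memLp_tfShift g z).integrable_mul (q := 2) (Lp.memLp u).star

theorem integral_norm_tfShift_mul_conj_le (u : L2 d) (z : Phase d) :
    ∫ t, ‖tfShift g z t * (starRingEnd ℂ) (u t)‖ ≤ ‖g‖ * ‖u‖ := by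
  have h1 := eLpNorm_smul_le_mul_eLpNorm (p := 2) (q := 2) (r := 1)
    (f := fun t => (starRingEnd ℂ) (u t)) (φ := tfShift g z) (μ := volume)
    (Lp.memLp u).star.1 (memLp_tfShift g z).1
  rw [integral_norm_eq_lintegral_enorm (integrable_tfShift_mul_conj g u z).1,
    ← eLpNorm_one_eq_lintegral_enorm]
  have h2 : eLpNorm (tfShift g z) 2 volume = ENNReal.ofReal ‖g‖ := by
    rw [← norm_tfL2 g z, tfL2, Lp.norm_toLp, ENNReal.ofReal_toReal (memLp_tfShift g z).2.ne]
  have h3 : eLpNorm (fun t => (starRingEnd ℂ) (u t)) 2 volume = ENNReal.ofReal ‖u‖ := by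
    rw [Lp.norm_def, ENNReal.ofReal_toReal (Lp.memLp u).2.ne]
    exact eLpNorm_congr_norm_ae (.of_forall fun t => by simp)
  rw [h2, h3, ← ENNReal.ofReal_mul (norm_nonneg _)] at h1
  exact ENNReal.toReal_le_of_le_ofReal (by positivity) h1

/-- Absolute integrability behind the weak form of the localization operator. -/
theorem integrable_stft_mul_tfShift (f u : L2 d) :
    Integrable (fun p : Phase d × Rd d => stft g f p.1 * tfShift g p.1 p.2 * (starRingEnd ℂ) (u p.2))
      (((volume : Measure (Phase d)).restrict Ω).prod volume) := by
  have hm : StronglyMeasurable (fun p : Phase d × Rd d =>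
      stft g f p.1 * tfShift g p.1 p.2 * (starRingEnd ℂ) (u p.2)) :=
    (((stronglyMeasurable_stft g f).comp_measurable measurable_fst).mul
      (stronglyMeasurable_tfShift (Lp.stronglyMeasurable g))).mul
      (RCLike.continuous_conj.comp_stronglyMeasurable
        ((Lp.stronglyMeasurable u).comp_measurable measurable_snd))
  rw [integrable_prod_iff hm.aestronglyMeasurable]
  constructor
  · refine .of_forall fun z => ?_
    simpa only [mul_assoc] using (integrable_tfShift_mul_conj g u z).const_mul (stft g f z)
  · refine Integrable.of_bound hm.norm.integral_prod_right'.aestronglyMeasurable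
      ((‖g‖ * ‖f‖) * (‖g‖ * ‖u‖)) (.of_forall fun z => ?_)
    rw [Real.norm_of_nonneg (by positivity)]
    simp only [mul_assoc, norm_mul (stft g f z)]
    rw [integral_const_mul, ← mul_assoc]
    exact mul_le_mul (norm_stft_le g f z) (integral_norm_tfShift_mul_conj_le g u z) (by positivity)
      (by positivity)

/-- Fubini turns the pointwise integral into the sesquilinear form of `B†B`. Integrability is
recorded because `locOp g Ω f` is not yet known to lie in `L²`. -/
theorem integral_locOp_mul_conj (f u : L2 d) :
    Integrable (fun t => locOp g Ω f t * (starRingEnd ℂ) (u t)) ∧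
    ∫ t, locOp g Ω f t * (starRingEnd ℂ) (u t) =
      ∫ z in Ω, stft g f z * (starRingEnd ℂ) (stft g u z) := by
  have hi := integrable_stft_mul_tfShift g Ω f u
  have e : ∀ t, ∫ z in Ω, stft g f z * tfShift g z t * (starRingEnd ℂ) (u t) =
      locOp g Ω f t * (starRingEnd ℂ) (u t) := fun t => by
    rw [integral_mul_const, locOp_eq_integral_tfShift]
  constructor
  · simpa only [e] using hi.integral_prod_right
  · simp_rw [← e]
    rw [← integral_integral_swap (f := fun (z : Phase d) (t : Rd d) =>
      stft g f z * tfShift g z t * (starRingEnd ℂ) (u t)) hi]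
    simp only [mul_assoc, integral_const_mul, integral_tfShift_mul_conj]

/-- The weak form is tested on indicators of sets of finite measure, which determine a locally
integrable function almost everywhere. -/
theorem locL2_ae_eq (f : L2 d) : (locL2 g Ω f : Rd d → ℂ) =ᵐ[volume] locOp g Ω f := by
  have key : ∀ s : Set (Rd d), MeasurableSet s → volume s < ∞ →
      IntegrableOn (locOp g Ω f) s ∧ ∫ t in s, locOp g Ω f t = ∫ t in s, locL2 g Ω f t := by
    intro s hs hμ
    have h := integral_locOp_mul_conj g Ω f (indicatorConstLp 2 hs hμ.ne (1 : ℂ))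
    have hae : (fun t => locOp g Ω f t * (starRingEnd ℂ) (indicatorConstLp 2 hs hμ.ne (1 : ℂ) t))
        =ᵐ[volume] s.indicator (locOp g Ω f) := by
      filter_upwards [indicatorConstLp_coeFn (p := 2) (hs := hs) (hμs := hμ.ne) (c := (1 : ℂ))]
        with t ht
      rw [ht]
      by_cases hts : t ∈ s <;> simp [hts]
    refine ⟨(integrable_indicator_iff hs).1 (h.1.congr hae), ?_⟩
    rw [← integral_indicator hs, ← integral_congr_ae hae, h.2, ← inner_locL2,
      L2.inner_indicatorConstLp_one]
  refine ae_eq_of_forall_setIntegral_eq_of_sigmaFinite (fun s hs hμ => ?_)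
    (fun s hs hμ => (key s hs hμ).1) (fun s hs hμ => (key s hs hμ).2.symm)
  exact integrableOn_Lp_of_measure_ne_top _ fact_one_le_two_ennreal.elim hμ.ne

/-- At each `z`, Bessel's inequality for `π(z)g` bounds the sum of the spectrograms by `‖g‖²`; this
is then integrated over `Ω`. -/
theorem sum_norm_stftRestrict_sq_le {ι : Type*} {e : ι → L2 d} (he : Orthonormal ℂ e)
    (s : Finset ι) : ∑ i ∈ s, ‖stftRestrict g Ω (e i)‖ ^ 2 ≤
      (volume : Measure (Phase d)).real Ω * ‖g‖ ^ 2 := by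
  simp_rw [norm_stftRestrict_sq]
  rw [← integral_finsetSum]
  · calc _ ≤ ∫ z in Ω, ‖g‖ ^ 2 := by
          refine integral_mono_of_nonneg (.of_forall fun z => by positivity)
            (integrable_const _) (.of_forall fun z => ?_)
          simp only [stft_eq_inner]
          simp_rw [norm_inner_symm (tfL2 g z)]
          exact (he.sum_inner_products_le (tfL2 g z)).trans_eq (by rw [norm_tfL2])
      _ = _ := by simp
  · exact fun i _ => (memLp_stft_restrict g Ω (e i)).integrable_norm_pow (by norm_num)

theorem summable_norm_stftRestrict_sq {ι : Type*} {e : ι → L2 d} (he : Orthonormal ℂ e) :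
    Summable fun i => ‖stftRestrict g Ω (e i)‖ ^ 2 :=
  summable_of_sum_le (fun _ => by positivity) (sum_norm_stftRestrict_sq_le g Ω he)

theorem isCompactOperator_stftRestrict : IsCompactOperator (stftRestrict g Ω) := by
  obtain ⟨w, b, hb⟩ := exists_hilbertBasis ℂ (L2 d)
  exact isCompactOperator_of_summable_norm_sq _ b (summable_norm_stftRestrict_sq g Ω b.orthonormal)

end Operator

/-! ### Enumerating eigenvalues in non-increasing order. -/

section Ordering

/-- An enumeration of `{k : ℕ | k < N}` by `Nat.nth`. -/
theorem exists_equiv_strictMono_of_set_nat (S : Set ℕ) :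
    ∃ (N : ℕ∞) (σ : {k : ℕ // (k : ℕ∞) < N} ≃ S), ∀ j k, j.1 ≤ k.1 → (σ j).1 ≤ (σ k).1 := by
  classical
  rcases S.finite_or_infinite with hS | hS
  · obtain ⟨s, rfl⟩ := hS.exists_finset_coe
    have e := s.orderIsoOfFin rfl
    let τ : {k : ℕ // (k : ℕ∞) < (s.card : ℕ∞)} ≃ Fin s.card :=
      { toFun := fun k => ⟨k.1, by exact_mod_cast k.2⟩
        invFun := fun k => ⟨k.1, by exact_mod_cast k.2⟩
        left_inv := fun k => rfl
        right_inv := fun k => rfl }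
    exact ⟨s.card, τ.trans e.toEquiv, fun j k hjk => e.monotone (show τ j ≤ τ k from hjk)⟩
  · have : Infinite S := hS.to_subtype
    let e := Nat.Subtype.orderIsoOfNat S
    let τ : {k : ℕ // (k : ℕ∞) < ⊤} ≃ ℕ :=
      { toFun := fun k => k.1
        invFun := fun k => ⟨k, ENat.natCast_lt_top k⟩
        left_inv := fun k => rfl
        right_inv := fun k => rfl }
    exact ⟨⊤, τ.trans e.toEquiv, fun j k hjk => e.monotone hjk⟩

/-- A summable positive family can be enumerated in non-increasing order. -/
theorem exists_antitone_enumeration {ι : Type*} {μ : ι → ℝ} (hpos : ∀ i, 0 < μ i)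
    (hs : Summable μ) :
    ∃ (N : ℕ∞) (σ : {k : ℕ // (k : ℕ∞) < N} ≃ ι), ∀ j k, j.1 ≤ k.1 → μ (σ k) ≤ μ (σ j) := by
  have hc : Countable ι := by
    have h := hs.countable_support
    rw [Function.support_eq_univ fun i => (hpos i).ne'] at h
    exact Set.countable_univ_iff.1 h
  obtain ⟨c, hcinj⟩ := exists_injective_nat ι
  have hfin : ∀ i, {j | μ i ≤ μ j}.Finite := fun i => by
    have h := hs.tendsto_cofinite_zero.eventually_lt_const (hpos i)
    simpa [Filter.eventually_cofinite] using h
  -- `A i` is the set of predecessors of `i` when indices are ordered by decreasing `μ`, ties being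
  -- broken by the injection `c`. Summability makes it finite, so its cardinality serves as the rank
  -- of `i`.
  let A : ι → Set ι := fun i => {j | μ i < μ j ∨ (μ j = μ i ∧ c j < c i)}
  have hA : ∀ i, (A i).Finite := fun i =>
    (hfin i).subset fun j hj => hj.elim le_of_lt fun h => h.1.ge
  have hmono : ∀ i j, j ∈ A i → (A j).ncard < (A i).ncard := fun i j hj => by
    refine Set.ncard_lt_ncard ⟨fun k hk => ?_, fun h => ?_⟩ (hA i)
    · simp only [A, Set.mem_ofPred_eq] at hj hk ⊢
      rcases hj with hj | ⟨hj, hj'⟩ <;> rcases hk with hk | ⟨hk, hk'⟩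
      · exact .inl (hj.trans hk)
      · exact .inl (hk ▸ hj)
      · exact .inl (hj ▸ hk)
      · exact .inr ⟨hk.trans hj, hk'.trans hj'⟩
    · have := h hj
      simp [A] at this
  let r : ι → ℕ := fun i => (A i).ncard
  have hrinj : Function.Injective r := fun i j hij => by
    by_contra hne
    have hcne : c i ≠ c j := fun h => hne (hcinj h)
    have : j ∈ A i ∨ i ∈ A j := by
      simp only [A, Set.mem_ofPred_eq]
      rcases lt_trichotomy (μ i) (μ j) with h | h | h
      · exact .inl (.inl h)
      · rcases hcne.lt_or_gt with h' | h'
        · exact .inr (.inr ⟨h, h'⟩)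
        · exact .inl (.inr ⟨h.symm, h'⟩)
      · exact .inr (.inl h)
    rcases this with h | h
    · exact (hmono _ _ h).ne' hij
    · exact (hmono _ _ h).ne hij
  obtain ⟨N, σ, hσ⟩ := exists_equiv_strictMono_of_set_nat (Set.range r)
  let ρ := Equiv.ofInjective r hrinj
  refine ⟨N, σ.trans ρ.symm, fun j k hjk => ?_⟩
  by_contra! h
  have h1 := hmono (ρ.symm (σ j)) (ρ.symm (σ k)) (.inl h)
  have h2 : ∀ x, (A (ρ.symm x)).ncard = x.1 := fun x =>
    congrArg Subtype.val (ρ.apply_symm_apply x)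
  rw [h2, h2] at h1
  exact absurd (hσ j k hjk) (not_le.2 h1)

end Ordering

/-! ### Spectral theorem for compact symmetric operators. -/

section Spectral

open Module.End

variable {H K : Type} [NormedAddCommGroup H] [InnerProductSpace ℂ H] [CompleteSpace H]
  [NormedAddCommGroup K] [InnerProductSpace ℂ K] [CompleteSpace K]

/-- A compact symmetric operator has a Hilbert basis of eigenvectors. -/
theorem exists_hilbertBasis_eigenvectors (T : H →L[ℂ] H) (hT : IsCompactOperator T)
    (hT' : T.IsSymmetric) :
    ∃ (ι : Type) (b : HilbertBasis ι ℂ H) (μ : ι → ℂ), ∀ i, T (b i) = μ i • b i := by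
  have hcomp : ∀ μ : ℂ, CompleteSpace (eigenspace (T : H →ₗ[ℂ] H) μ) := fun μ => by
    have : IsClosed ((eigenspace (T : H →ₗ[ℂ] H) μ : Submodule ℂ H) : Set H) := by
      have e : ((eigenspace (T : H →ₗ[ℂ] H) μ : Submodule ℂ H) : Set H) =
          {x | T x = μ • x} := by
        ext x; simp
      rw [e]
      exact isClosed_eq T.continuous (continuous_const_smul μ)
    exact this.completeSpace_coe
  choose w b hb using fun μ : ℂ => exists_hilbertBasis ℂ (eigenspace (T : H →ₗ[ℂ] H) μ)
  -- The eigenvalue `0` is included, so the kernel is covered too and the family is total.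
  let v : (Σ μ : ℂ, w μ) → H := fun i => (b i.1 i.2 : H)
  have hv : Orthonormal ℂ v :=
    (hT'.orthogonalFamily_eigenspaces).orthonormal_sigma_orthonormal fun μ => (b μ).orthonormal
  have hv' : (Submodule.span ℂ (Set.range v))ᗮ = ⊥ := by
    rw [eq_bot_iff, ← ContinuousLinearMap.orthogonalComplement_iSup_eigenspaces_eq_bot hT hT',
      ← Submodule.iInf_orthogonal]
    refine le_iInf fun μ x hx => ?_
    rw [Submodule.mem_orthogonal] at hx ⊢
    intro u hu
    have hsum := (b μ).hasSum_repr ⟨u, hu⟩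
    have hsum' : HasSum (fun i => ((b μ).repr ⟨u, hu⟩ i • (b μ i : H))) u := by
      simpa using (eigenspace (T : H →ₗ[ℂ] H) μ).subtypeL.hasSum hsum
    have h3 := (innerSL ℂ x).hasSum hsum'
    have h4 : ∀ i, innerSL ℂ x ((b μ).repr ⟨u, hu⟩ i • (b μ i : H)) = 0 := fun i => by
      have := hx (v ⟨μ, i⟩) (Submodule.subset_span ⟨_, rfl⟩)
      rw [map_smul, innerSL_apply_apply, inner_eq_zero_symm.1 this, smul_zero]
    simp only [h4] at h3
    exact inner_eq_zero_symm.1 (h3.unique hasSum_zero)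
  refine ⟨_, HilbertBasis.mkOfOrthogonalEqBot hv hv', fun i => i.1, fun i => ?_⟩
  rw [HilbertBasis.coe_mkOfOrthogonalEqBot]
  exact mem_eigenspace_iff.1 (b i.1 i.2).2

/-- Diagonalization of `B† B` for a Hilbert–Schmidt operator `B`. -/
theorem exists_diagonalization_adjoint_comp (B : H →L[ℂ] K) (hc : IsCompactOperator B)
    (hs : ∀ {ι : Type} {e : ι → H}, Orthonormal ℂ e → Summable fun i => ‖B (e i)‖ ^ 2) :
    ∃ (N : ℕ∞) (lam : ℕ → ℝ) (h : ℕ → H),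
      (∀ k : ℕ, (k : ℕ∞) < N → lam k ≠ 0) ∧
      (∀ j k : ℕ, j ≤ k → (k : ℕ∞) < N → lam k ≤ lam j) ∧
      (Orthonormal ℂ (fun k : {k : ℕ // (k : ℕ∞) < N} => h k)) ∧
      ∀ f : H, HasSum (fun k : {k : ℕ // (k : ℕ∞) < N} => ((lam k : ℂ) * inner ℂ (h k) f) • h k)
        (B.adjoint (B f)) := by
  classical
  let T : H →L[ℂ] H := B.adjoint ∘L B
  have hTs : T.IsSymmetric := fun x y => by
    simp [T, ContinuousLinearMap.adjoint_inner_left, ContinuousLinearMap.adjoint_inner_right]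
  obtain ⟨ι, b, μ, hμ⟩ := exists_hilbertBasis_eigenvectors T (hc.clm_comp B.adjoint) hTs
  have hμB : ∀ i, μ i = ((‖B (b i)‖ ^ 2 : ℝ) : ℂ) := fun i => by
    have h1 : inner ℂ (b i) (T (b i)) = μ i := by
      rw [hμ, inner_smul_right, inner_self_eq_norm_sq_to_K, b.orthonormal.1]; simp
    rw [← h1]
    simp [T, ContinuousLinearMap.adjoint_inner_right, inner_self_eq_norm_sq_to_K]
  -- Basis vectors in the kernel are discarded: they contribute nothing to the expansion, and the
  -- listed eigenvalues must be nonzero.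
  let J := {i // 0 < ‖B (b i)‖ ^ 2}
  obtain ⟨N, σ, hσ⟩ := exists_antitone_enumeration (ι := J) (μ := fun i => ‖B (b i.1)‖ ^ 2)
    (fun i => i.2) ((hs b.orthonormal).subtype _)
  refine ⟨N, fun k => if hk : (k : ℕ∞) < N then ‖B (b (σ ⟨k, hk⟩).1)‖ ^ 2 else 0,
    fun k => if hk : (k : ℕ∞) < N then b (σ ⟨k, hk⟩).1 else 0, ?_, ?_, ?_, ?_⟩
  · intro k hk
    simp only [dif_pos hk]
    exact (σ ⟨k, hk⟩).2.ne'
  · intro j k hjk hk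
    have hj : (j : ℕ∞) < N := lt_of_le_of_lt (by exact_mod_cast hjk) hk
    simp only [dif_pos hk, dif_pos hj]
    exact hσ ⟨j, hj⟩ ⟨k, hk⟩ hjk
  · have e : (fun k : {k : ℕ // (k : ℕ∞) < N} =>
        if hk : ((k : ℕ) : ℕ∞) < N then b (σ ⟨k, hk⟩).1 else 0) = b ∘ fun k => (σ k).1 := by
      funext k; simp [k.2]
    rw [e]
    exact b.orthonormal.comp _ (Subtype.val_injective.comp σ.injective)
  · intro f
    have h1 : HasSum (fun i => (((‖B (b i)‖ ^ 2 : ℝ) : ℂ) * inner ℂ (b i) f) • b i) (T f) := by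
      have := T.hasSum (b.hasSum_repr f)
      refine this.congr_fun fun i => ?_
      rw [map_smul, hμ, hμB, b.repr_apply_apply, smul_smul, mul_comm]
    have h2 : HasSum (fun i : J => (((‖B (b i.1)‖ ^ 2 : ℝ) : ℂ) * inner ℂ (b i.1) f) • b i.1)
        (T f) := by
      refine (hasSum_subtype_iff_of_support_subset (s := {i | 0 < ‖B (b i)‖ ^ 2}) ?_).2 h1
      intro i hi
      by_contra hi'
      have : ‖B (b i)‖ ^ 2 = 0 := le_antisymm (not_lt.1 hi') (by positivity)
      rw [Function.mem_support, this] at hi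
      simp at hi
    have h3 := (σ.hasSum_iff).2 h2
    refine h3.congr_fun fun k => ?_
    simp [k.2]

end Spectral

theorem exists_isDiagonalization (g : L2 d) {Ω : Set (Phase d)} (hΩ : volume Ω < ∞) :
    ∃ (N : ℕ∞) (lam : ℕ → ℝ) (h : ℕ → L2 d), IsDiagonalization g Ω N lam h := by
  have : IsFiniteMeasure ((volume : Measure (Phase d)).restrict Ω) := ⟨by simpa using hΩ⟩
  obtain ⟨N, lam, h, h1, h2, h3, h4⟩ := exists_diagonalization_adjoint_comp (stftRestrict g Ω)
    (isCompactOperator_stftRestrict g Ω) (fun he => summable_norm_stftRestrict_sq g Ω he)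
  exact ⟨N, lam, h, h1, h2, h3, fun f => ⟨locL2 g Ω f, locL2_ae_eq g Ω f, h4 f⟩⟩

/-! ### Translation estimate for sets of finite perimeter. -/

section BoundedVariation

open scoped Convolution

variable {ι : Type} [Fintype ι]

/-- Mollification by bumps of integral one preserves the bound by `1`. Almost everywhere convergence
is Lebesgue differentiation, which needs the ratio of outer to inner radius bounded, here by `2`. -/
theorem exists_smooth_approx {F : EuclideanSpace ℝ ι → ℝ} (hF : LocallyIntegrable F)
    (hs : HasCompactSupport F) (hb : ∀ x, |F x| ≤ 1) :
    ∃ ψ : ℕ → EuclideanSpace ℝ ι → ℝ, (∀ n, ContDiff ℝ 1 (ψ n)) ∧ (∀ n, HasCompactSupport (ψ n)) ∧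
      (∀ n x, |ψ n x| ≤ 1) ∧
      ∀ᵐ x, Filter.Tendsto (fun n => ψ n x) Filter.atTop (nhds (F x)) := by
  let φ : ℕ → ContDiffBump (0 : EuclideanSpace ℝ ι) := fun n =>
    ⟨1 / (n + 1) / 2, 1 / (n + 1), by positivity, half_lt_self (by positivity)⟩
  refine ⟨fun n => ((φ n).normed volume ⋆[ContinuousLinearMap.lsmul ℝ ℝ, volume] F),
    fun n => ?_, fun n => ?_, fun n x => ?_, ?_⟩
  · exact (φ n).hasCompactSupport_normed.contDiff_convolution_left _ (φ n).contDiff_normed hF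
  · exact (φ n).hasCompactSupport_normed.convolution _ hs
  · change ‖((φ n).normed volume ⋆[ContinuousLinearMap.lsmul ℝ ℝ, volume] F) x‖ ≤ 1
    rw [convolution_def]
    refine (norm_integral_le_of_norm_le (φ n).integrable_normed (.of_forall fun t => ?_)).trans_eq
      (φ n).integral_normed
    rw [ContinuousLinearMap.lsmul_apply, norm_smul, Real.norm_of_nonneg ((φ n).nonneg_normed t)]
    exact mul_le_of_le_one_right ((φ n).nonneg_normed t) (hb _)
  · refine ContDiffBump.ae_convolution_tendsto_right_of_locallyIntegrable (K := 2) ?_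
      (.of_forall fun n => ?_) hF
    · exact tendsto_one_div_add_atTop_nhds_zero_nat
    · simp only [φ]; linarith

variable [DecidableEq ι]

theorem divergence_smul_const {ψ : EuclideanSpace ℝ ι → ℝ} (hψ : Differentiable ℝ ψ)
    (v x : EuclideanSpace ℝ ι) : divergence (fun x => ψ x • v) x = fderiv ℝ ψ x v := by
  have h : fderiv ℝ (fun x => ψ x • v) x = (fderiv ℝ ψ x).smulRight v := by
    rw [fderiv_smul_const (hψ x)]
  rw [divergence, h]
  conv_rhs => rw [← (EuclideanSpace.basisFun ι ℝ).sum_repr v]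
  simp [mul_comm]

/-- The field `ψ v / ‖v‖` is admissible in the definition of the perimeter, and its divergence is
the derivative of `ψ` along `v / ‖v‖`. -/
theorem setIntegral_fderiv_le {Ω : Set (EuclideanSpace ℝ ι)} (hΩ : MeasurableSet Ω)
    (hper : perimeter Ω < ∞) {ψ : EuclideanSpace ℝ ι → ℝ} (hψ : ContDiff ℝ 1 ψ)
    (hs : HasCompactSupport ψ) (hb : ∀ x, |ψ x| ≤ 1) (v : EuclideanSpace ℝ ι) :
    ∫ x in Ω, fderiv ℝ ψ x v ≤ ‖v‖ * (perimeter Ω).toReal := by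
  rcases eq_or_ne v 0 with rfl | hv
  · simp
  have hv' : 0 < ‖v‖ := norm_pos_iff.2 hv
  let φ : EuclideanSpace ℝ ι → EuclideanSpace ℝ ι := fun x => ψ x • (‖v‖⁻¹ • v)
  have h1 : ENNReal.ofReal (∫ x, Ω.indicator (fun _ => (1 : ℝ)) x * divergence φ x)
      ≤ perimeter Ω := by
    refine le_iSup_of_le φ (le_iSup_of_le (hψ.smul contDiff_const)
      (le_iSup_of_le hs.smul_right (le_iSup_of_le (fun x => ?_) le_rfl)))
    simp only [φ, norm_smul, norm_inv, norm_norm, inv_mul_cancel₀ hv'.ne', mul_one]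
    exact hb x
  have h2 : ∫ x, Ω.indicator (fun _ => (1 : ℝ)) x * divergence φ x =
      ‖v‖⁻¹ * ∫ x in Ω, fderiv ℝ ψ x v := by
    rw [← integral_const_mul, ← integral_indicator hΩ]
    refine integral_congr_ae (.of_forall fun x => ?_)
    simp only [φ]
    rw [divergence_smul_const (hψ.differentiable (by norm_num))]
    by_cases hx : x ∈ Ω <;> simp [hx]
  rw [h2] at h1
  have h3 := (ENNReal.ofReal_le_iff_le_toReal hper.ne).1 h1
  rwa [inv_mul_le_iff₀ hv'] at h3

/-- The increment is the integral of a directional derivative along the segment from `x` to `x - y`.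
After exchanging integrals, each slice is the derivative bound for a translate of `ψ`. -/
theorem setIntegral_sub_translate_le {Ω : Set (EuclideanSpace ℝ ι)} (hΩ : MeasurableSet Ω)
    (hvol : volume Ω < ∞)
    (hper : perimeter Ω < ∞) {ψ : EuclideanSpace ℝ ι → ℝ} (hψ : ContDiff ℝ 1 ψ)
    (hs : HasCompactSupport ψ) (hb : ∀ x, |ψ x| ≤ 1) (y : EuclideanSpace ℝ ι) :
    ∫ x in Ω, (ψ (x - y) - ψ x) ≤ ‖y‖ * (perimeter Ω).toReal := by
  have : IsFiniteMeasure ((volume : Measure (EuclideanSpace ℝ ι)).restrict Ω) := ⟨by simpa using hvol⟩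
  have hdiff := hψ.differentiable (by norm_num)
  have hcont : Continuous (fderiv ℝ ψ) := hψ.continuous_fderiv (by norm_num)
  have hline : ∀ x (s : ℝ), HasDerivAt (fun s : ℝ => ψ (x - s • y)) (fderiv ℝ ψ (x - s • y) (-y)) s := by
    intro x s
    have h1 : HasDerivAt (fun s : ℝ => x - s • y) (-y) s := by
      simpa using ((hasDerivAt_id s).smul_const y).const_sub x
    exact (hdiff _).hasFDerivAt.comp_hasDerivAt s h1
  have hGc : Continuous (fun p : EuclideanSpace ℝ ι × ℝ => fderiv ℝ ψ (p.1 - p.2 • y) (-y)) := by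
    fun_prop
  have hftc : ∀ x, ψ (x - y) - ψ x = ∫ s in (0 : ℝ)..1, fderiv ℝ ψ (x - s • y) (-y) := fun x => by
    rw [intervalIntegral.integral_eq_sub_of_hasDerivAt (fun s _ => hline x s)]
    · simp
    · exact (Continuous.intervalIntegrable (by fun_prop) _ _)
  obtain ⟨C, hC⟩ := hcont.bounded_above_of_compact_support (hs.fderiv ℝ)
  have hint : Integrable (Function.uncurry fun (x : EuclideanSpace ℝ ι) (s : ℝ) =>
      fderiv ℝ ψ (x - s • y) (-y)) ((volume.restrict Ω).prod (volume.restrict (Set.Ioc 0 1))) := by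
    refine Integrable.of_bound hGc.aestronglyMeasurable (C * ‖-y‖) (.of_forall fun p => ?_)
    exact ContinuousLinearMap.le_of_opNorm_le _ (hC _) _
  simp_rw [hftc, intervalIntegral.integral_of_le zero_le_one]
  rw [integral_integral_swap hint]
  have hslice : ∀ s : ℝ, ∫ x in Ω, fderiv ℝ ψ (x - s • y) (-y) ≤ ‖y‖ * (perimeter Ω).toReal := by
    intro s
    have h := setIntegral_fderiv_le hΩ hper (ψ := fun x => ψ (x - s • y)) (by fun_prop)
      (hs.comp_homeomorph (Homeomorph.subRight (s • y))) (fun x => hb _) (-y)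
    simpa only [fderiv_comp_sub, norm_neg] using h
  calc _ ≤ ∫ s in Set.Ioc (0 : ℝ) 1, ‖y‖ * (perimeter Ω).toReal :=
        integral_mono_ae hint.integral_prod_right (integrable_const _) (.of_forall hslice)
    _ = _ := by simp

/-- Sets of finite perimeter: the `L¹` modulus of continuity of the indicator function. -/
theorem integral_abs_translate_sub_le {Ω : Set (EuclideanSpace ℝ ι)} (hΩ : IsCompact Ω)
    (hper : perimeter Ω < ∞) (y : EuclideanSpace ℝ ι) :
    ∫ x, |Ω.indicator (fun _ => (1 : ℝ)) (x + y) - Ω.indicator (fun _ => (1 : ℝ)) x| ≤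
      ‖y‖ * (perimeter Ω).toReal := by
  set f : EuclideanSpace ℝ ι → ℝ := Ω.indicator (fun _ => (1 : ℝ)) with hf
  have hfi : Integrable f :=
    (integrable_indicator_iff hΩ.measurableSet).2 (integrableOn_const hΩ.measure_lt_top.ne)
  have hfs : HasCompactSupport f := by
    refine HasCompactSupport.intro hΩ fun x hx => by simp [f, hx]
  set F : EuclideanSpace ℝ ι → ℝ := fun x => f (x + y) - f x with hFdef
  have hFi : Integrable F := (hfi.comp_add_right y).sub hfi
  have hFs : HasCompactSupport F :=
    (hfs.comp_homeomorph (Homeomorph.addRight y)).sub hfs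
  -- `F` takes only the values `-1, 0, 1`, so it is its own sign: smooth approximations of `F` are
  -- the right test functions for `∫ |F|`.
  have hFv : ∀ x, |F x| ≤ 1 ∧ F x * F x = |F x| := fun x => by
    by_cases h1 : x + y ∈ Ω <;> by_cases h2 : x ∈ Ω <;> simp [F, f, h1, h2]
  obtain ⟨ψ, hψ1, hψ2, hψ3, hψ4⟩ :=
    exists_smooth_approx hFi.locallyIntegrable hFs fun x => (hFv x).1
  have hψi : ∀ n, Integrable (ψ n) := fun n =>
    (hψ1 n).continuous.integrable_of_hasCompactSupport (hψ2 n)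
  have hle : ∀ n, ∫ x, F x * ψ n x ≤ ‖y‖ * (perimeter Ω).toReal := fun n => by
    have h := setIntegral_sub_translate_le hΩ.measurableSet hΩ.measure_lt_top hper (hψ1 n) (hψ2 n)
      (hψ3 n) y
    refine le_of_eq_of_le ?_ h
    have hi1 : Integrable fun x => f x * ψ n (x - y) :=
      ((hψi n).comp_sub_right y).bdd_mul (c := 1) hfi.aestronglyMeasurable
        (.of_forall fun x => by by_cases h : x ∈ Ω <;> simp [f, h])
    have hi2 : Integrable fun x => f x * ψ n x :=
      (hψi n).bdd_mul (c := 1) hfi.aestronglyMeasurable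
        (.of_forall fun x => by by_cases h : x ∈ Ω <;> simp [f, h])
    have hi3 : Integrable fun x => f (x + y) * ψ n x := by
      simpa using hi1.comp_add_right y
    -- The translation is moved from the indicator to the test function, where it can be
    -- differentiated.
    have e1 : ∫ x, f (x + y) * ψ n x = ∫ x, f x * ψ n (x - y) := by
      rw [← integral_add_right_eq_self (fun x => f x * ψ n (x - y)) y]
      simp
    calc ∫ x, F x * ψ n x = (∫ x, f (x + y) * ψ n x) - ∫ x, f x * ψ n x := by
          rw [← integral_sub hi3 hi2]
          exact integral_congr_ae (.of_forall fun x => by simp only [F]; ring)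
      _ = ∫ x, f x * (ψ n (x - y) - ψ n x) := by
          rw [e1, ← integral_sub hi1 hi2]
          exact integral_congr_ae (.of_forall fun x => by ring)
      _ = _ := by
          rw [← integral_indicator hΩ.measurableSet]
          refine integral_congr_ae (.of_forall fun x => ?_)
          by_cases h : x ∈ Ω <;> simp [f, h]
  have hlim : Filter.Tendsto (fun n => ∫ x, F x * ψ n x) Filter.atTop (nhds (∫ x, F x * F x)) := by
    refine tendsto_integral_of_dominated_convergence (fun x => |F x|)
      (fun n => hFi.aestronglyMeasurable.mul (hψi n).aestronglyMeasurable) hFi.abs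
      (fun n => .of_forall fun x => ?_) (hψ4.mono fun x hx => hx.const_mul _)
    rw [norm_mul, Real.norm_eq_abs, Real.norm_eq_abs]
    exact mul_le_of_le_one_right (abs_nonneg _) (hψ3 n x)
  have := le_of_tendsto' hlim hle
  rwa [integral_congr_ae (.of_forall fun x => (hFv x).2)] at this

end BoundedVariation

/-! ### Counting eigenvalues. -/

/-- A non-increasing sequence in `[0, 1]` with sum `v` is close in `ℓ¹` to the indicator of its
first `⌈v⌉` indices when `∑ a (1 - a)` is small. -/
theorem tsum_abs_indicator_sub_le {a : ℕ → ℝ} (ha : Antitone a) (h0 : ∀ k, 0 ≤ a k)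
    (h1 : ∀ k, a k ≤ 1) (hs : Summable a) {D : ℝ} (hD : ∑' k, a k * (1 - a k) ≤ D) :
    Summable (fun k => |(if k < ⌈∑' k, a k⌉₊ then 1 else 0) - a k|) ∧
      ∑' k, |(if k < ⌈∑' k, a k⌉₊ then 1 else 0) - a k| ≤ 4 * D + 1 := by
  set A := ⌈∑' k, a k⌉₊ with hA
  have hv0 : 0 ≤ ∑' k, a k := tsum_nonneg h0
  have hA1 : ∑' k, a k ≤ A := Nat.le_ceil _
  have hA2 : (A : ℝ) ≤ ∑' k, a k + 1 := (Nat.ceil_lt_add_one hv0).le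
  set p := ∑ k ∈ Finset.range A, (1 - a k) with hp
  set q := ∑' k, a (k + A) with hq
  have hsq : Summable fun k => a (k + A) := (summable_nat_add_iff A).2 hs
  have hsplit := hs.sum_add_tsum_nat_add A
  have hpq : p - q = A - ∑' k, a k := by
    rw [← hsplit, hp, hq, Finset.sum_sub_distrib]; simp; ring
  have ht0 : ∀ k, 0 ≤ a k * (1 - a k) := fun k => mul_nonneg (h0 k) (by linarith [h1 k])
  have hts : Summable fun k => a k * (1 - a k) :=
    hs.of_nonneg_of_le ht0 fun k => mul_le_of_le_one_right (h0 k) (by linarith [h0 k])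
  have htsplit := hts.sum_add_tsum_nat_add A
  have htsq : Summable fun k => a (k + A) * (1 - a (k + A)) := (summable_nat_add_iff A).2 hts
  have hT1 : 0 ≤ ∑ k ∈ Finset.range A, a k * (1 - a k) := Finset.sum_nonneg fun k _ => ht0 k
  have hT2 : 0 ≤ ∑' k, a (k + A) * (1 - a (k + A)) := tsum_nonneg fun k => ht0 _
  -- If `a A ≤ 1/2`, then `a ≤ 2 a (1 - a)` beyond `A`, so `q ≤ 2D` and `p + q = 2q + (p - q)` with
  -- `p - q ≤ 1`. Otherwise `1 - a ≤ 2 a (1 - a)` before `A`, so `p ≤ 2D` and `q ≤ p`.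
  have hbound : p + q ≤ 4 * D + 1 := by
    rcases le_or_gt (a A) (1 / 2) with h | h
    · have : q ≤ 2 * ∑' k, a (k + A) * (1 - a (k + A)) := by
        rw [← tsum_mul_left]
        refine hsq.tsum_le_tsum (fun k => ?_) (htsq.mul_left 2)
        have h2 := ha (Nat.le_add_left A k)
        nlinarith [h0 (k + A)]
      linarith
    · have : p ≤ 2 * ∑ k ∈ Finset.range A, a k * (1 - a k) := by
        rw [Finset.mul_sum]
        refine Finset.sum_le_sum fun k hk => ?_
        have h2 := ha (Finset.mem_range.1 hk).le
        nlinarith [h1 k]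
      linarith
  have hcs : Summable (fun k => |(if k < A then (1 : ℝ) else 0) - a k|) := by
    rw [← summable_nat_add_iff A]
    refine hsq.congr fun k => ?_
    simp [abs_of_nonneg (h0 _)]
  refine ⟨hcs, ?_⟩
  rw [← hcs.sum_add_tsum_nat_add A]
  refine le_trans (le_of_eq ?_) hbound
  congr 1
  · refine Finset.sum_congr rfl fun k hk => ?_
    rw [if_pos (Finset.mem_range.1 hk), abs_of_nonneg (by linarith [h1 k])]
  · refine tsum_congr fun k => ?_
    simp [abs_of_nonneg (h0 _)]

/-! ### Smoothing the indicator by the window's spectrogram. -/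

/-- The smoothed indicator `∫_Ω |V_g g(w - z)|² dw`. -/
def smoothInd (g : L2 d) (Ω : Set (Phase d)) (z : Phase d) : ℝ := ∫ w in Ω, ‖stft g g (w - z)‖ ^ 2

theorem smoothInd_nonneg (g : L2 d) (Ω : Set (Phase d)) (z : Phase d) : 0 ≤ smoothInd g Ω z :=
  integral_nonneg fun _ => by positivity

theorem integrable_norm_stft_sq (g f : L2 d) : Integrable fun z => ‖stft g f z‖ ^ 2 := by
  refine ⟨((measurable_stft g f).norm.pow_const 2).aestronglyMeasurable, ?_⟩
  rw [hasFiniteIntegral_iff_enorm]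
  simp only [enorm_pow, enorm_norm]
  rw [lintegral_enorm_stft_sq]
  exact ENNReal.mul_lt_top (ENNReal.pow_lt_top enorm_lt_top) (ENNReal.pow_lt_top enorm_lt_top)

theorem integral_norm_stft_sq (g f : L2 d) : ∫ z, ‖stft g f z‖ ^ 2 = ‖g‖ ^ 2 * ‖f‖ ^ 2 := by
  rw [integral_eq_lintegral_of_nonneg_ae (.of_forall fun z => by positivity)
    (integrable_norm_stft_sq g f).aestronglyMeasurable]
  have h := lintegral_enorm_stft_sq g f
  simp only [← ofReal_norm, ← ENNReal.ofReal_pow (norm_nonneg _)] at h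
  rw [h, ← ENNReal.ofReal_mul (by positivity), ENNReal.toReal_ofReal (by positivity)]

theorem indicator_translate_mul_integrable (g : L2 d) {Ω : Set (Phase d)} (hΩ : MeasurableSet Ω)
    (z : Phase d) :
    Integrable fun y => Ω.indicator (fun _ => (1 : ℝ)) (z + y) * ‖stft g g y‖ ^ 2 := by
  refine (integrable_norm_stft_sq g g).bdd_mul (c := 1)
    ((measurable_const.indicator hΩ).comp (measurable_const_add z)).aestronglyMeasurable
    (.of_forall fun y => ?_)
  by_cases h : z + y ∈ Ω <;> simp [h]

theorem smoothInd_eq (g : L2 d) {Ω : Set (Phase d)} (hΩ : MeasurableSet Ω) (z : Phase d) :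
    smoothInd g Ω z = ∫ y, Ω.indicator (fun _ => (1 : ℝ)) (z + y) * ‖stft g g y‖ ^ 2 := by
  rw [smoothInd, ← integral_indicator hΩ, ← integral_add_left_eq_self _ z]
  refine integral_congr_ae (.of_forall fun y => ?_)
  by_cases h : z + y ∈ Ω <;> simp [h]

/-- As `|V_g g|²` has integral one, `1_Ω(z)` can be placed under the integral, exposing the
increments of `1_Ω`. -/
theorem smoothInd_sub_indicator (g : L2 d) (hg : ‖g‖ = 1) {Ω : Set (Phase d)}
    (hΩ : MeasurableSet Ω) (z : Phase d) :
    smoothInd g Ω z - Ω.indicator (fun _ => (1 : ℝ)) z =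
      ∫ y, (Ω.indicator (fun _ => (1 : ℝ)) (z + y) - Ω.indicator (fun _ => (1 : ℝ)) z) *
        ‖stft g g y‖ ^ 2 := by
  simp only [sub_mul]
  rw [integral_sub (indicator_translate_mul_integrable g hΩ z)
    ((integrable_norm_stft_sq g g).const_mul _), integral_const_mul, integral_norm_stft_sq, hg,
    smoothInd_eq g hΩ]
  simp

/-- Smoothing the indicator of `Ω` by the spectrogram of the window moves it in `L¹` by at most
`‖g‖²_{M*} |∂Ω|`. -/
theorem lintegral_enorm_smoothInd_sub_le (g : L2 d) (hg : ‖g‖ = 1) {Ω : Set (Phase d)}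
    (hΩ : IsCompact Ω) (hper : perimeter Ω < ∞) :
    ∫⁻ z, ‖smoothInd g Ω z - Ω.indicator (fun _ => (1 : ℝ)) z‖ₑ ≤
      mStarNormSq g * perimeter Ω := by
  have hm1 : Measurable (Ω.indicator (fun _ => (1 : ℝ))) :=
    measurable_const.indicator hΩ.measurableSet
  have hm2 : Measurable fun y => ‖‖stft g g y‖ ^ 2‖ₑ := ((measurable_stft g g).norm.pow_const 2).enorm
  have hm3 : ∀ y : Phase d, Measurable fun z =>
      ‖Ω.indicator (fun _ => (1 : ℝ)) (z + y) - Ω.indicator (fun _ => (1 : ℝ)) z‖ₑ := fun y =>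
    ((hm1.comp (measurable_add_const y)).sub hm1).enorm
  have hm4 : Measurable fun p : Phase d × Phase d =>
      ‖Ω.indicator (fun _ => (1 : ℝ)) (p.1 + p.2) - Ω.indicator (fun _ => (1 : ℝ)) p.1‖ₑ *
        ‖‖stft g g p.2‖ ^ 2‖ₑ :=
    (((hm1.comp (measurable_fst.add measurable_snd)).sub (hm1.comp measurable_fst)).enorm).mul
      (hm2.comp measurable_snd)
  have hind : Integrable (Ω.indicator (fun _ => (1 : ℝ))) :=
    (integrable_indicator_iff hΩ.measurableSet).2 (integrableOn_const hΩ.measure_lt_top.ne)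
  have hbv : ∀ y, ∫⁻ z, ‖Ω.indicator (fun _ => (1 : ℝ)) (z + y) -
      Ω.indicator (fun _ => (1 : ℝ)) z‖ₑ ≤ ENNReal.ofReal ‖y‖ * perimeter Ω := fun y => by
    have h := integral_abs_translate_sub_le hΩ hper y
    have hi := (hind.comp_add_right y).sub hind
    have h' := ENNReal.ofReal_le_ofReal h
    rw [ENNReal.ofReal_mul (norm_nonneg _), ENNReal.ofReal_toReal hper.ne] at h'
    refine le_of_eq_of_le ?_ h'
    simp only [← Real.norm_eq_abs]
    exact (ofReal_integral_norm_eq_lintegral_enorm hi).symm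
  calc _ ≤ ∫⁻ z, ∫⁻ y, ‖Ω.indicator (fun _ => (1 : ℝ)) (z + y) -
        Ω.indicator (fun _ => (1 : ℝ)) z‖ₑ * ‖‖stft g g y‖ ^ 2‖ₑ := by
        refine lintegral_mono fun z => ?_
        rw [smoothInd_sub_indicator g hg hΩ.measurableSet]
        exact (enorm_integral_le_lintegral_enorm _).trans_eq (by simp only [enorm_mul])
    _ = ∫⁻ y, (∫⁻ z, ‖Ω.indicator (fun _ => (1 : ℝ)) (z + y) -
        Ω.indicator (fun _ => (1 : ℝ)) z‖ₑ) * ‖‖stft g g y‖ ^ 2‖ₑ := by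
        rw [lintegral_lintegral_swap hm4.aemeasurable]
        exact lintegral_congr fun y => lintegral_mul_const _ (hm3 y)
    _ ≤ ∫⁻ y, ENNReal.ofReal (‖y‖ * ‖stft g g y‖ ^ 2) * perimeter Ω := by
        refine lintegral_mono fun y => ?_
        rw [ENNReal.ofReal_mul (norm_nonneg _), Real.enorm_of_nonneg (by positivity : 0 ≤ ‖stft g g y‖ ^ 2),
          mul_right_comm]
        exact mul_le_mul_left (hbv y) _
    _ = _ := by
        have hm : Measurable fun y : Phase d => ENNReal.ofReal (‖y‖ * ‖stft g g y‖ ^ 2) :=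
          (measurable_norm.mul ((measurable_stft g g).norm.pow_const 2)).ennreal_ofReal
        rw [lintegral_mul_const _ hm, mStarNormSq]

/-! ### Consequences of an arbitrary diagonalization. -/

section Diagonalization

variable {g : L2 d} {Ω : Set (Phase d)} {N : ℕ∞} {lam : ℕ → ℝ} {h : ℕ → L2 d}

/-- The eigenvalues, extended by zero. -/
def extendZero (N : ℕ∞) (lam : ℕ → ℝ) (k : ℕ) : ℝ := by
  classical exact if (k : ℕ∞) < N then lam k else 0

theorem extendZero_of_lt {k : ℕ} (hk : (k : ℕ∞) < N) : extendZero N lam k = lam k := if_pos hk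

theorem extendZero_of_not_lt {k : ℕ} (hk : ¬ (k : ℕ∞) < N) : extendZero N lam k = 0 := if_neg hk

namespace IsDiagonalization

/-- The expansion is paired with `f`, and `⟨f, B†B f⟩ = ‖B f‖²`. Extending `lam` by zero turns the
sum over `k < N` into one over `ℕ` and silences the meaningless `h k`. -/
theorem hasSum_norm_inner_sq (hd : IsDiagonalization g Ω N lam h) (hΩ : volume Ω < ∞) (f : L2 d) :
    HasSum (fun k => extendZero N lam k * ‖(inner ℂ (h k) f : ℂ)‖ ^ 2)
      (∫ z in Ω, ‖stft g f z‖ ^ 2) := by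
  have : IsFiniteMeasure ((volume : Measure (Phase d)).restrict Ω) := ⟨by simpa using hΩ⟩
  obtain ⟨F, hF, hsum⟩ := hd.expansion f
  have hFT : F = locL2 g Ω f := Lp.ext (hF.trans (locL2_ae_eq g Ω f).symm)
  have h1 := (innerSL ℂ f).hasSum hsum
  simp only [innerSL_apply_apply, inner_smul_right] at h1
  have h2 : HasSum (fun k : {k : ℕ // (k : ℕ∞) < N} => lam k * ‖(inner ℂ (h k) f : ℂ)‖ ^ 2)
      (∫ z in Ω, ‖stft g f z‖ ^ 2) := by
    refine Complex.hasSum_ofReal.1 ?_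
    have e : ((∫ z in Ω, ‖stft g f z‖ ^ 2 : ℝ) : ℂ) = inner ℂ f F := by
      rw [← norm_stftRestrict_sq, hFT, locL2, ContinuousLinearMap.comp_apply,
        ContinuousLinearMap.adjoint_inner_right, inner_self_eq_norm_sq_to_K]
      push_cast
      rfl
    rw [e]
    refine h1.congr_fun fun k => ?_
    rw [mul_assoc, ← inner_conj_symm f (h k), RCLike.mul_conj]
    push_cast
    rfl
  have h3 := hasSum_subtype_iff_of_support_subset (s := {k : ℕ | (k : ℕ∞) < N})
    (f := fun k => extendZero N lam k * ‖(inner ℂ (h k) f : ℂ)‖ ^ 2)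
    (a := ∫ z in Ω, ‖stft g f z‖ ^ 2) fun k hk => by
      by_contra hk'
      exact hk (by simp only [extendZero_of_not_lt hk', zero_mul])
  refine h3.1 (h2.congr_fun fun k => ?_)
  simp only [Function.comp]
  rw [extendZero_of_lt k.2]

theorem extendZero_eq (hd : IsDiagonalization g Ω N lam h) (hΩ : volume Ω < ∞) {k : ℕ}
    (hk : (k : ℕ∞) < N) : extendZero N lam k = ∫ z in Ω, ‖stft g (h k) z‖ ^ 2 := by
  have h1 := hd.hasSum_norm_inner_sq hΩ (h k)
  refine HasSum.unique ?_ h1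
  convert hasSum_ite_eq k (extendZero N lam k) using 2 with j
  split_ifs with hjk
  · subst hjk
    have := hd.orthonormal.1 ⟨j, hk⟩
    simp only at this
    rw [inner_self_eq_norm_sq_to_K, this]
    simp
  · by_cases hj : (j : ℕ∞) < N
    · have := hd.orthonormal.2 (i := ⟨j, hj⟩) (j := ⟨k, hk⟩) (by simpa using hjk)
      simp only at this
      simp [this]
    · simp [extendZero_of_not_lt hj]

theorem extendZero_nonneg (hd : IsDiagonalization g Ω N lam h) (hΩ : volume Ω < ∞) (k : ℕ) :
    0 ≤ extendZero N lam k := by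
  by_cases hk : (k : ℕ∞) < N
  · rw [hd.extendZero_eq hΩ hk]
    exact integral_nonneg fun z => by positivity
  · rw [extendZero_of_not_lt hk]

theorem integral_norm_stft_eq_one (hd : IsDiagonalization g Ω N lam h) (hg : ‖g‖ = 1) {k : ℕ}
    (hk : (k : ℕ∞) < N) : ∫ z, ‖stft g (h k) z‖ ^ 2 = 1 := by
  rw [integral_norm_stft_sq, hg, hd.orthonormal.1 ⟨k, hk⟩]; norm_num

theorem extendZero_le_one (hd : IsDiagonalization g Ω N lam h) (hg : ‖g‖ = 1)
    (hΩ : volume Ω < ∞) (k : ℕ) : extendZero N lam k ≤ 1 := by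
  by_cases hk : (k : ℕ∞) < N
  · rw [hd.extendZero_eq hΩ hk, ← hd.integral_norm_stft_eq_one hg hk]
    exact setIntegral_le_integral (integrable_norm_stft_sq g (h k))
      (.of_forall fun z => by positivity)
  · rw [extendZero_of_not_lt hk]; exact zero_le_one

theorem antitone_extendZero (hd : IsDiagonalization g Ω N lam h) (hΩ : volume Ω < ∞) :
    Antitone (extendZero N lam) := fun j k hjk => by
  by_cases hk : (k : ℕ∞) < N
  · have hj : (j : ℕ∞) < N := lt_of_le_of_lt (by exact_mod_cast hjk) hk
    rw [extendZero_of_lt hk, extendZero_of_lt hj]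
    exact hd.antitone j k hjk hk
  · rw [extendZero_of_not_lt hk]
    exact hd.extendZero_nonneg hΩ j

/-- This is the quadratic form at `f = π(z)g`, whose spectrogram is `|V_g g|²` translated by `z`. -/
theorem hasSum_smoothInd (hd : IsDiagonalization g Ω N lam h) (hΩ : volume Ω < ∞) (z : Phase d) :
    HasSum (fun k => extendZero N lam k * ‖stft g (h k) z‖ ^ 2) (smoothInd g Ω z) := by
  have h1 := hd.hasSum_norm_inner_sq hΩ (tfL2 g z)
  simp only [norm_stft_tfL2] at h1
  refine h1.congr_fun fun k => ?_
  rw [stft_eq_inner, norm_inner_symm]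

theorem ofReal_smoothInd (hd : IsDiagonalization g Ω N lam h) (hΩ : volume Ω < ∞) (z : Phase d) :
    ENNReal.ofReal (smoothInd g Ω z) =
      ∑' k, ENNReal.ofReal (extendZero N lam k) * ENNReal.ofReal (‖stft g (h k) z‖ ^ 2) := by
  have h1 := hd.hasSum_smoothInd hΩ z
  rw [← h1.tsum_eq, ENNReal.ofReal_tsum_of_nonneg
    (fun k => mul_nonneg (hd.extendZero_nonneg hΩ k) (by positivity)) h1.summable]
  exact tsum_congr fun k => ENNReal.ofReal_mul (hd.extendZero_nonneg hΩ k)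

theorem lintegral_smoothInd (hd : IsDiagonalization g Ω N lam h) (hΩ : volume Ω < ∞)
    (μ : Measure (Phase d)) : ∫⁻ z, ENNReal.ofReal (smoothInd g Ω z) ∂μ =
      ∑' k, ENNReal.ofReal (extendZero N lam k) *
        ∫⁻ z, ENNReal.ofReal (‖stft g (h k) z‖ ^ 2) ∂μ := by
  have hm : ∀ k, Measurable fun z => ENNReal.ofReal (‖stft g (h k) z‖ ^ 2) := fun k =>
    ((measurable_stft g (h k)).norm.pow_const 2).ennreal_ofReal
  simp_rw [hd.ofReal_smoothInd hΩ]
  rw [lintegral_tsum fun k => ((hm k).const_mul _).aemeasurable]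
  exact tsum_congr fun k => lintegral_const_mul _ (hm k)

/-- The trace of the localization operator. -/
theorem tsum_ofReal_extendZero (hd : IsDiagonalization g Ω N lam h) (hg : ‖g‖ = 1)
    (hm : MeasurableSet Ω) (hΩ : volume Ω < ∞) :
    ∑' k, ENNReal.ofReal (extendZero N lam k) = volume Ω := by
  -- The integral of the smoothed indicator over the plane is computed twice: termwise, it is the
  -- sum of the eigenvalues; by Tonelli, it is `|Ω|` times the integral of `|V_g g|²`.
  have h1 := hd.lintegral_smoothInd hΩ volume
  have h2 : ∀ k, ENNReal.ofReal (extendZero N lam k) *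
      ∫⁻ z, ENNReal.ofReal (‖stft g (h k) z‖ ^ 2) = ENNReal.ofReal (extendZero N lam k) := by
    intro k
    by_cases hk : (k : ℕ∞) < N
    · rw [← ofReal_integral_eq_lintegral_ofReal (integrable_norm_stft_sq g (h k))
        (.of_forall fun z => by positivity), hd.integral_norm_stft_eq_one hg hk]
      simp
    · simp [extendZero_of_not_lt hk]
  rw [← tsum_congr h2, ← h1]
  have h3 : ∀ z, ENNReal.ofReal (smoothInd g Ω z) = ∫⁻ y, Ω.indicator (fun _ => (1 : ℝ≥0∞)) (z + y) *
      ENNReal.ofReal (‖stft g g y‖ ^ 2) := fun z => by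
    rw [smoothInd_eq g hm, ofReal_integral_eq_lintegral_ofReal
      (indicator_translate_mul_integrable g hm z) (.of_forall fun y => by
        refine mul_nonneg (Set.indicator_nonneg (fun _ _ => zero_le_one) _) (by positivity))]
    refine lintegral_congr fun y => ?_
    by_cases h : z + y ∈ Ω <;> simp [h]
  have hmi : Measurable (Ω.indicator (fun _ => (1 : ℝ≥0∞))) := measurable_const.indicator hm
  have hms : Measurable fun y => ENNReal.ofReal (‖stft g g y‖ ^ 2) :=
    ((measurable_stft g g).norm.pow_const 2).ennreal_ofReal
  simp_rw [h3]
  rw [lintegral_lintegral_swap ((hmi.comp (measurable_fst.add measurable_snd)).mul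
    (hms.comp measurable_snd)).aemeasurable]
  have h4 : ∀ y, ∫⁻ z, Ω.indicator (fun _ => (1 : ℝ≥0∞)) (z + y) *
      ENNReal.ofReal (‖stft g g y‖ ^ 2) = volume Ω * ENNReal.ofReal (‖stft g g y‖ ^ 2) := by
    intro y
    have hmy : Measurable fun z => Ω.indicator (fun _ => (1 : ℝ≥0∞)) (z + y) :=
      hmi.comp (measurable_add_const y)
    rw [lintegral_mul_const _ hmy,
      lintegral_add_right_eq_self (Ω.indicator (fun _ => (1 : ℝ≥0∞))) y, lintegral_indicator_const hm, one_mul]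
  simp_rw [h4]
  rw [lintegral_const_mul _ hms, ← ofReal_integral_eq_lintegral_ofReal (integrable_norm_stft_sq g g)
        (.of_forall fun z => by positivity), integral_norm_stft_sq, hg]
  simp

theorem summable_extendZero (hd : IsDiagonalization g Ω N lam h) (hg : ‖g‖ = 1)
    (hm : MeasurableSet Ω) (hΩ : volume Ω < ∞) : Summable (extendZero N lam) := by
  have h1 := ENNReal.summable_toReal ((hd.tsum_ofReal_extendZero hg hm hΩ).trans_ne hΩ.ne)
  exact h1.congr fun k => ENNReal.toReal_ofReal (hd.extendZero_nonneg hΩ k)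

theorem tsum_extendZero (hd : IsDiagonalization g Ω N lam h) (hg : ‖g‖ = 1)
    (hm : MeasurableSet Ω) (hΩ : volume Ω < ∞) :
    ∑' k, extendZero N lam k = (volume Ω).toReal := by
  rw [← hd.tsum_ofReal_extendZero hg hm hΩ, ← ENNReal.ofReal_tsum_of_nonneg
    (hd.extendZero_nonneg hΩ) (hd.summable_extendZero hg hm hΩ),
    ENNReal.toReal_ofReal (tsum_nonneg (hd.extendZero_nonneg hΩ))]

/-- The trace of `H - H²` is controlled by the smoothing error. -/
theorem tsum_mul_one_sub_le (hd : IsDiagonalization g Ω N lam h) (hg : ‖g‖ = 1)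
    (hm : MeasurableSet Ω) (hΩ : volume Ω < ∞)
    (hD : ∫⁻ z, ‖smoothInd g Ω z - Ω.indicator (fun _ => (1 : ℝ)) z‖ₑ ≠ ∞) :
    ∑' k, extendZero N lam k * (1 - extendZero N lam k) ≤
      (∫⁻ z, ‖smoothInd g Ω z - Ω.indicator (fun _ => (1 : ℝ)) z‖ₑ).toReal := by
  set D := ∫⁻ z, ‖smoothInd g Ω z - Ω.indicator (fun _ => (1 : ℝ)) z‖ₑ
  have hs := hd.summable_extendZero hg hm hΩ
  have h0 := hd.extendZero_nonneg hΩ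
  have h1 := hd.extendZero_le_one hg hΩ
  have hs2 : Summable fun k => extendZero N lam k * extendZero N lam k :=
    hs.of_nonneg_of_le (fun k => mul_nonneg (h0 k) (h0 k))
      fun k => mul_le_of_le_one_right (h0 k) (h1 k)
  -- Over `Ω` the spectrogram of `h k` integrates to the eigenvalue itself, so each term is a
  -- square.
  have hsq : ∫⁻ z in Ω, ENNReal.ofReal (smoothInd g Ω z) =
      ENNReal.ofReal (∑' k, extendZero N lam k * extendZero N lam k) := by
    rw [hd.lintegral_smoothInd hΩ, ENNReal.ofReal_tsum_of_nonneg
      (fun k => mul_nonneg (h0 k) (h0 k)) hs2]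
    refine tsum_congr fun k => ?_
    rw [ENNReal.ofReal_mul (h0 k)]
    by_cases hk : (k : ℕ∞) < N
    · rw [← ofReal_integral_eq_lintegral_ofReal (integrable_norm_stft_sq g (h k)).integrableOn
        (.of_forall fun z => by positivity), ← hd.extendZero_eq hΩ hk]
    · simp [extendZero_of_not_lt hk]
  have hle : volume Ω ≤ ENNReal.ofReal (∑' k, extendZero N lam k * extendZero N lam k) + D := by
    rw [← hsq]
    have hmeas : Measurable fun z => ENNReal.ofReal (smoothInd g Ω z) := by
      simp_rw [hd.ofReal_smoothInd hΩ]
      exact Measurable.tsum fun k =>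
        ((measurable_stft g (h k)).norm.pow_const 2).ennreal_ofReal.const_mul _
    calc volume Ω = ∫⁻ z in Ω, 1 := by simp
      _ ≤ ∫⁻ z in Ω, (ENNReal.ofReal (smoothInd g Ω z) +
          ‖smoothInd g Ω z - Ω.indicator (fun _ => (1 : ℝ)) z‖ₑ) := by
          refine setLIntegral_mono' hm fun z hz => ?_
          rw [Set.indicator_of_mem hz, Real.enorm_eq_ofReal_abs, ← ENNReal.ofReal_add
            (smoothInd_nonneg g Ω z) (abs_nonneg _), ← ENNReal.ofReal_one]
          refine ENNReal.ofReal_le_ofReal ?_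
          linarith [neg_abs_le (smoothInd g Ω z - 1)]
      _ = (∫⁻ z in Ω, ENNReal.ofReal (smoothInd g Ω z)) +
          ∫⁻ z in Ω, ‖smoothInd g Ω z - Ω.indicator (fun _ => (1 : ℝ)) z‖ₑ :=
          lintegral_add_left hmeas _
      _ ≤ _ := by gcongr; exact setLIntegral_le_lintegral _ _
  have hle' := ENNReal.toReal_mono (ENNReal.add_ne_top.2 ⟨ENNReal.ofReal_ne_top, hD⟩) hle
  rw [ENNReal.toReal_add ENNReal.ofReal_ne_top hD,
    ENNReal.toReal_ofReal (tsum_nonneg fun k => mul_nonneg (h0 k) (h0 k)),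
    ← hd.tsum_extendZero hg hm hΩ] at hle'
  simp only [mul_sub, mul_one]
  rw [hs.tsum_sub hs2]
  linarith

/-- The eigenvalues are at most `1` and add up to `|Ω|`, so finitely many of them number at least
`|Ω|`. -/
theorem numEig_le (hd : IsDiagonalization g Ω N lam h) (hg : ‖g‖ = 1)
    (hm : MeasurableSet Ω) (hΩ : volume Ω < ∞) : (numEig Ω : ℕ∞) ≤ N := by
  rcases eq_or_ne N ⊤ with rfl | hN
  · exact le_top
  lift N to ℕ using hN
  rw [numEig, Nat.cast_le, Nat.ceil_le, ← hd.tsum_extendZero hg hm hΩ,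
    tsum_eq_sum (s := Finset.range N) fun k hk => extendZero_of_not_lt (by simpa using hk)]
  exact (Finset.sum_le_sum fun k _ => hd.extendZero_le_one hg hΩ k).trans_eq (by simp)

theorem lintegral_enorm_accSpectrogram_sub_smoothInd_le (hd : IsDiagonalization g Ω N lam h)
    (hg : ‖g‖ = 1) (hm : MeasurableSet Ω) (hΩ : volume Ω < ∞)
    (hD : ∫⁻ z, ‖smoothInd g Ω z - Ω.indicator (fun _ => (1 : ℝ)) z‖ₑ ≠ ∞) :
    ∫⁻ z, ‖accSpectrogram g Ω h z - smoothInd g Ω z‖ₑ ≤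
      4 * (∫⁻ z, ‖smoothInd g Ω z - Ω.indicator (fun _ => (1 : ℝ)) z‖ₑ) + 1 := by
  set D := ∫⁻ z, ‖smoothInd g Ω z - Ω.indicator (fun _ => (1 : ℝ)) z‖ₑ
  set c : ℕ → ℝ := fun k => (if k < numEig Ω then 1 else 0) - extendZero N lam k with hc
  obtain ⟨hs, hle⟩ := tsum_abs_indicator_sub_le (hd.antitone_extendZero hΩ)
    (hd.extendZero_nonneg hΩ) (hd.extendZero_le_one hg hΩ) (hd.summable_extendZero hg hm hΩ)
    (hd.tsum_mul_one_sub_le hg hm hΩ hD)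
  rw [hd.tsum_extendZero hg hm hΩ] at hs hle
  have hsum : ∀ z, HasSum (fun k => c k * ‖stft g (h k) z‖ ^ 2)
      (accSpectrogram g Ω h z - smoothInd g Ω z) := fun z => by
    have h1 : HasSum (fun k => (if k < numEig Ω then 1 else 0) * ‖stft g (h k) z‖ ^ 2)
        (accSpectrogram g Ω h z) := by
      have : accSpectrogram g Ω h z = ∑ k ∈ Finset.range (numEig Ω),
          (if k < numEig Ω then 1 else 0) * ‖stft g (h k) z‖ ^ 2 :=
        Finset.sum_congr rfl fun k hk => by
          rw [if_pos (Finset.mem_range.1 hk), one_mul]; rfl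
      rw [this]
      refine hasSum_sum_of_ne_finset_zero fun k hk => ?_
      rw [if_neg (by simpa using hk), zero_mul]
    refine (h1.sub (hd.hasSum_smoothInd hΩ z)).congr_fun fun k => ?_
    simp only [hc]; ring
  have hpt : ∀ z, ‖accSpectrogram g Ω h z - smoothInd g Ω z‖ₑ ≤
      ∑' k, ‖c k‖ₑ * ENNReal.ofReal (‖stft g (h k) z‖ ^ 2) := fun z => by
    rw [← (hsum z).tsum_eq]
    refine (enorm_tsum_le_tsum_enorm).trans_eq (tsum_congr fun k => ?_)
    rw [enorm_mul, Real.enorm_of_nonneg (by positivity : 0 ≤ ‖stft g (h k) z‖ ^ 2)]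
  have hmk : ∀ k, Measurable fun z => ENNReal.ofReal (‖stft g (h k) z‖ ^ 2) := fun k =>
    ((measurable_stft g (h k)).norm.pow_const 2).ennreal_ofReal
  have hone : ∀ k, ‖c k‖ₑ * ∫⁻ z, ENNReal.ofReal (‖stft g (h k) z‖ ^ 2) = ENNReal.ofReal |c k| := by
    intro k
    by_cases hk : (k : ℕ∞) < N
    · rw [← ofReal_integral_eq_lintegral_ofReal (integrable_norm_stft_sq g (h k))
        (.of_forall fun z => by positivity), hd.integral_norm_stft_eq_one hg hk,
        Real.enorm_eq_ofReal_abs]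
      simp
    -- For `k ≥ N` nothing is known about `h k`, so its coefficient must vanish; this uses `numEig Ω
    -- ≤ N`.
    · have hk' : ¬ k < numEig Ω := fun h' =>
        hk (lt_of_lt_of_le (by exact_mod_cast h') (hd.numEig_le hg hm hΩ))
      have : c k = 0 := by simp [hc, hk', extendZero_of_not_lt hk]
      simp [this]
  calc _ ≤ ∫⁻ z, ∑' k, ‖c k‖ₑ * ENNReal.ofReal (‖stft g (h k) z‖ ^ 2) := lintegral_mono hpt
    _ = ∑' k, ENNReal.ofReal |c k| := by
        rw [lintegral_tsum fun k => ((hmk k).const_mul _).aemeasurable]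
        exact tsum_congr fun k => (lintegral_const_mul _ (hmk k)).trans (hone k)
    _ = ENNReal.ofReal (∑' k, |c k|) :=
        (ENNReal.ofReal_tsum_of_nonneg (fun k => abs_nonneg _) hs).symm
    _ ≤ ENNReal.ofReal (4 * D.toReal + 1) := ENNReal.ofReal_le_ofReal hle
    _ = _ := by
        rw [ENNReal.ofReal_add (by positivity) zero_le_one, ENNReal.ofReal_mul (by norm_num),
          ENNReal.ofReal_toReal hD]
        simp

end IsDiagonalization

end Diagonalization

end AccSpec

end

/-! ### The main estimate. -/

theorem mainTheorem1 (d : ℕ) (g : AccSpec.L2 d) (hg : ‖g‖ = 1)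
    (hgM : AccSpec.mStarNormSq g < ∞) :
    ∃ C : ℝ≥0, ∀ Ω : Set (AccSpec.Phase d), IsCompact Ω →
      AccSpec.perimeter Ω < ∞ → 1 ≤ AccSpec.perimeter Ω →
      (∃ (N : ℕ∞) (lam : ℕ → ℝ) (h : ℕ → AccSpec.L2 d),
        AccSpec.IsDiagonalization g Ω N lam h) ∧
      ∀ (N : ℕ∞) (lam : ℕ → ℝ) (h : ℕ → AccSpec.L2 d),
        AccSpec.IsDiagonalization g Ω N lam h →
        (AccSpec.numEig Ω : ℕ∞) ≤ N ∧
        eLpNorm (fun z => AccSpec.accSpectrogram g Ω h z - Ω.indicator (fun _ => (1 : ℝ)) z)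
          1 volume ≤ (C : ℝ≥0∞) * AccSpec.perimeter Ω := by
  -- In the `5`, four come from eigenvalue counting and one from smoothing. The `+ 1` pays for
  -- rounding `|Ω|` up, using `1 ≤ |∂Ω|`.
  refine ⟨5 * (AccSpec.mStarNormSq g).toNNReal + 1, fun Ω hΩ hper hper1 =>
    ⟨AccSpec.exists_isDiagonalization g hΩ.measure_lt_top, fun N lam h hd =>
      ⟨hd.numEig_le hg hΩ.measurableSet hΩ.measure_lt_top, ?_⟩⟩⟩
  have hD := AccSpec.lintegral_enorm_smoothInd_sub_le g hg hΩ hper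
  have hE := hd.lintegral_enorm_accSpectrogram_sub_smoothInd_le hg hΩ.measurableSet
    hΩ.measure_lt_top (ne_top_of_le_ne_top (ENNReal.mul_ne_top hgM.ne hper.ne) hD)
  have hm : Measurable fun z => ‖AccSpec.accSpectrogram g Ω h z - AccSpec.smoothInd g Ω z‖ₑ := by
    have h1 : Measurable (AccSpec.accSpectrogram g Ω h) :=
      Finset.measurable_sum _ fun k _ => (AccSpec.measurable_stft g (h k)).norm.pow_const 2
    have h2 : Measurable (AccSpec.smoothInd g Ω) := by
      have : StronglyMeasurable fun p : AccSpec.Phase d × AccSpec.Phase d =>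
          ‖AccSpec.stft g g (p.2 - p.1)‖ ^ 2 :=
        (((AccSpec.measurable_stft g g).comp
          (measurable_snd.sub measurable_fst)).norm.pow_const 2).stronglyMeasurable
      exact (this.integral_prod_right' (ν := volume.restrict Ω)).measurable
    exact (h1.sub h2).enorm
  rw [eLpNorm_one_eq_lintegral_enorm]
  calc _ ≤ ∫⁻ z, (‖AccSpec.accSpectrogram g Ω h z - AccSpec.smoothInd g Ω z‖ₑ +
        ‖AccSpec.smoothInd g Ω z - Ω.indicator (fun _ => (1 : ℝ)) z‖ₑ) :=
        lintegral_mono fun z => (enorm_add_le _ _).trans_eq' (by congr 1; ring)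
    _ ≤ (4 * (∫⁻ z, ‖AccSpec.smoothInd g Ω z - Ω.indicator (fun _ => (1 : ℝ)) z‖ₑ) + 1) +
        ∫⁻ z, ‖AccSpec.smoothInd g Ω z - Ω.indicator (fun _ => (1 : ℝ)) z‖ₑ := by
        rw [lintegral_add_left hm]
        gcongr
    _ ≤ (4 * (AccSpec.mStarNormSq g * AccSpec.perimeter Ω) + AccSpec.perimeter Ω) +
        AccSpec.mStarNormSq g * AccSpec.perimeter Ω := by gcongr
    _ = _ := by
        push_cast
        rw [ENNReal.coe_toNNReal hgM.ne]
        ring
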